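/- Let $\phi\in C^1(\mathbb R)$ be not identically zero, with $|\phi'|\le B$ and $\phi'$ $B$-Lipschitz for some $B>0$, and let $D\in\mathbb R$. There are constants $C,C'>0$, depending only on $\phi$ and $D$, such that the following holds for all dimensions $m,n,k,d$. Let $A:\mathbb R^n\to\mathbb R^m$ be linear and non-zero, with spectral norm $\|A\|$ and smallest non-zero singular value $\sigma_A$; let $\bar x\in\mathbb R^n$, $\varepsilon\in\mathbb R^m$ and $y=A\bar x+\varepsilon$. Let $\ell\in C^1(\mathbb R^m)$ be a loss with $\min\ell=0=\ell(y)$ whose gradient is Lipschitz on bounded sets, and suppose that $\ell$ satisfies the Kurdyka–Łojasiewicz inequality with desingularizing function $\psi$: for some $r_0>0$, $\psi\in C^0([0,r_0))\cap C^1((0,r_0))$ is strictly increasing, $\psi(0)=0$, and $\psi'(\ell(z))\,\|\nabla\ell(z)\|\ge 1$ whenever $0<\ell(z)<r_0$. Put $$\rho=C\|A\|\sqrt{n\log d}+\sqrt m\,(\|A\bar x\|_\infty+\|\varepsilon\|_\infty),\qquad L_{\ell,0}=\sup_{\|v\|\le\rho,\ v\ne y}\frac{\|\nabla\ell(v)\|}{\|v-y\|},\qquad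 a=\frac{L_{\ell,0}}2\,\rho^2,$$ and suppose that $a<r_0$, so that $\psi(a)$ is defined. Consider the network $g(u,\theta)=\frac1{\sqrt k}V\phi(Wu)$ with $\theta=(V,W)\in\mathbb R^{n\times k}\times\mathbb R^{k\times d}$ (Euclidean norm) and Jacobian $J_g(\theta)$ of $g(u,\cdot)$. Let $u$ be uniform on $\mathbb S^{d-1}$, let $W_0$ have iid $\mathcal N(0,1)$ entries and be independent of $u$, and let $V_0$ be independent of $(W_0,u)$ with iid columns of identity covariance and centered entries bounded by $D$ in absolute value. Put $\theta_0=(V_0,W_0)$, $y_0=Ag(u,\theta_0)$, and let $\sigma_{\min}(J_g(\theta_0))$ be the $n$-th (smallest) singular value of $J_g(\theta_0)$. For $L>0$ and a step size $\gamma\in(0,1/L]$ let $$R'=\frac{2\nu_1\,\psi(\ell(y_0))}{\sigma_A\,\sigma_{\min}(J_g(\theta_0))},\quad \nu_1=\frac{1+\gamma L}{1-\gamma L/2},\qquad R=\sup\Bigl\{r\ge0:\ 2r\,\mathrm{Lip}_{\mathbb B(\theta_0,r)}(J_g)\le\sigma_{\min}(J_g(\theta_0))\Bigr\}\in[0,\infty],$$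 where $\mathrm{Lip}_{\mathbb B(\theta_0,r)}(J_g)$ is the Lipschitz constant on the ball in spectral norm; $R$ is the solution of $R=\sigma_{\min}(J_g(\theta_0))/(2\,\mathrm{Lip}_{\mathbb B(\theta_0,R)}(J_g))$ whenever $\sigma_{\min}(J_g(\theta_0))>0$ and there is a solution $R>0$. If $$k\ \ge\ C'\,\sigma_A^{-4}\,n\,\psi\Bigl(\frac{L_{\ell,0}}2\bigl(C\|A\|\sqrt{n\log d}+\sqrt m(\|A\bar x\|_\infty+\|\varepsilon\|_\infty)\bigr)^2\Bigr)^4,$$ and if moreover $y$ is the only minimizer of $\ell$ or $k\ge C'n$, then with probability at least $1-2n^{-1}-d^{-1}$ one has $\sigma_{\min}(J_g(\theta_0))>0$, $\ell(y_0)<r_0$ (so that $R'$ is defined), and $R'<R$ for all $L>0$ and $\gamma\in(0,1/L]$. -/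

import Mathlib

open MeasureTheory ProbabilityTheory Set Metric
open scoped NNReal ENNReal

noncomputable section

namespace DIP

/-- `ℝᵃ` with the Euclidean norm. -/
abbrev Vec (a : ℕ) : Type := EuclideanSpace ℝ (Fin a)

/-- The parameter space `ℝᵖ`, `p = n k + k d`, of a two-layer network, with the Euclidean norm:
the entries of `V ∈ ℝ^{n × k}` followed by those of `W ∈ ℝ^{k × d}`. -/
abbrev Param (n k d : ℕ) : Type := EuclideanSpace ℝ ((Fin n × Fin k) ⊕ (Fin k × Fin d))

/-- The parameter vector that gathers the entries of `V` and `W`. -/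
def toParam {n k d : ℕ} (V : Fin n → Fin k → ℝ) (W : Fin k → Fin d → ℝ) : Param n k d :=
  WithLp.toLp 2 (Sum.elim (fun p => V p.1 p.2) (fun p => W p.1 p.2))

def outerWeights {n k d : ℕ} (θ : Param n k d) : Matrix (Fin n) (Fin k) ℝ :=
  Matrix.of fun i j => θ (Sum.inl (i, j))

def innerWeights {n k d : ℕ} (θ : Param n k d) : Matrix (Fin k) (Fin d) ℝ :=
  Matrix.of fun j l => θ (Sum.inr (j, l))

/-- The two-layer network `g(u, θ) = (1/√k) V φ(W u)`, `θ = (V, W)`, with `φ` acting entrywise. -/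
def net {n k d : ℕ} (φ : ℝ → ℝ) (u : Vec d) (θ : Param n k d) : Vec n :=
  WithLp.toLp 2 ((1 / √(k : ℝ)) •
    (outerWeights θ).mulVec (fun j => φ ((innerWeights θ).mulVec u.ofLp j)))

/-- The Jacobian of `g(u, ·)` at `θ`. -/
def jac {n k d : ℕ} (φ : ℝ → ℝ) (u : Vec d) (θ : Param n k d) : Param n k d →L[ℝ] Vec n :=
  fderiv ℝ (net φ u) θ

/-- The smallest non-zero singular value (`0` for the zero operator): Mathlib lists the singular
values in decreasing order, and exactly the first `rank T` of them are non-zero. -/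
def sigmaMin {E F : Type*} [NormedAddCommGroup E] [InnerProductSpace ℝ E] [FiniteDimensional ℝ E]
    [NormedAddCommGroup F] [InnerProductSpace ℝ F] [FiniteDimensional ℝ F] (T : E →L[ℝ] F) : ℝ :=
  (T : E →ₗ[ℝ] F).singularValues (Module.finrank ℝ (LinearMap.range (T : E →ₗ[ℝ] F)) - 1)

/-- The best Lipschitz constant of `f` on `s`, in `[0, ∞]`. -/
def lipConst {X Y : Type*} [PseudoEMetricSpace X] [PseudoEMetricSpace Y] (f : X → Y) (s : Set X) :
    ℝ≥0∞ :=
  ⨅ (K : ℝ≥0) (_ : LipschitzOnWith K f s), (K : ℝ≥0∞)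

/-- The radius `R ∈ [0, ∞]` of the equation `R = σ / (2 Lip_{B(z, R)}(J))`, as the largest `r` with
`2 r Lip_{B(z, r)}(J) ≤ σ`. The Lipschitz constant may jump as `r` grows, so that the equation may
have no solution; if it has one, it is this number (`radius_eq_of_fixedPoint`). -/
def radius {X Y : Type*} [PseudoMetricSpace X] [PseudoEMetricSpace Y] (J : X → Y) (z : X) (σ : ℝ) :
    ℝ≥0∞ :=
  ⨆ (r : ℝ≥0) (_ : 2 * (r : ℝ≥0∞) * lipConst J (closedBall z r) ≤ ENNReal.ofReal σ), (r : ℝ≥0∞)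

theorem lipConst_mono {X Y : Type*} [PseudoEMetricSpace X] [PseudoEMetricSpace Y] (f : X → Y)
    {s t : Set X} (h : s ⊆ t) : lipConst f s ≤ lipConst f t :=
  le_iInf₂ fun K hK => iInf₂_le K (hK.mono h)

theorem radius_eq_of_fixedPoint {X Y : Type*} [PseudoMetricSpace X] [PseudoEMetricSpace Y]
    (J : X → Y) (z : X) (σ : ℝ) (hσ : 0 < σ) (R : ℝ≥0)
    (hR : (R : ℝ≥0∞) = ENNReal.ofReal σ / (2 * lipConst J (closedBall z R))) (hR0 : R ≠ 0) :
    radius J z σ = R := by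
  set Λ := lipConst J (closedBall z R) with hΛ
  have hσ0 : ENNReal.ofReal σ ≠ 0 := by simpa using hσ
  have h0 : 2 * Λ ≠ 0 := by
    intro h
    rw [h, ENNReal.div_zero hσ0] at hR
    exact ENNReal.coe_ne_top hR
  have ht : 2 * Λ ≠ ∞ := by
    intro h
    rw [h, ENNReal.div_top] at hR
    exact hR0 (by simpa using hR)
  have key : (R : ℝ≥0∞) * (2 * Λ) = ENNReal.ofReal σ := by
    rw [hR]; exact ENNReal.div_mul_cancel h0 ht
  apply le_antisymm
  · refine iSup₂_le fun r hr => ?_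
    by_contra hlt
    push Not at hlt
    have hmono : Λ ≤ lipConst J (closedBall z r) :=
      lipConst_mono J (closedBall_subset_closedBall (by exact_mod_cast hlt.le))
    have h1 : (r : ℝ≥0∞) * (2 * Λ) ≤ (R : ℝ≥0∞) * (2 * Λ) := by
      calc (r : ℝ≥0∞) * (2 * Λ) = 2 * (r : ℝ≥0∞) * Λ := by ring
        _ ≤ 2 * (r : ℝ≥0∞) * lipConst J (closedBall z r) := by gcongr
        _ ≤ _ := by rw [key]; exact hr
    exact absurd ((ENNReal.mul_le_mul_iff_left h0 ht).1 h1) (not_le.2 hlt)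
  · exact le_iSup₂_of_le R (by rw [← key, ← hΛ]; apply le_of_eq; ring) le_rfl

/-- `f : ℝᵐ → ℝ` is `C¹`, `min f = 0`, and `f` satisfies the Kurdyka–Łojasiewicz inequality on
`[0 < f < r₀]` with the desingularizing function `ψ` (only its values on `[0, r₀)` matter). -/
structure IsKL {m : ℕ} (ψ : ℝ → ℝ) (r₀ : ℝ) (f : Vec m → ℝ) : Prop where
  contDiff : ContDiff ℝ 1 f
  min_eq : IsLeast (range f) 0
  r₀_pos : 0 < r₀
  psi_continuousOn : ContinuousOn ψ (Ico 0 r₀)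
  psi_contDiffOn : ContDiffOn ℝ 1 ψ (Ioo 0 r₀)
  psi_strictMonoOn : StrictMonoOn ψ (Ico 0 r₀)
  psi_zero : ψ 0 = 0
  ineq : ∀ z, 0 < f z → f z < r₀ → 1 ≤ deriv ψ (f z) * ‖gradient f z‖

/-- `φ` is `C¹`, `φ'` is bounded by `B` and `B`-Lipschitz for some `B > 0`. -/
def IsActivation (φ : ℝ → ℝ) : Prop :=
  ContDiff ℝ 1 φ ∧
    ∃ B : ℝ≥0, 0 < B ∧ (∀ x, |deriv φ x| ≤ B) ∧ LipschitzWith B (deriv φ)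

/-- The uniform probability measure on the unit sphere of `ℝᵈ`, as a measure on `ℝᵈ`. -/
def uniformSphere (d : ℕ) : Measure (Vec d) :=
  (((volume : Measure (Vec d)).toSphere univ)⁻¹ • (volume : Measure (Vec d)).toSphere).map
    Subtype.val

/-- The random initialization: `u` is uniform on the sphere, `W` has iid standard Gaussian entries
and is independent of `u`, and `V` is independent of `(W, u)` and has iid columns with identity
covariance and centered entries bounded by `D`. -/
structure IsInit {Ω : Type*} [MeasurableSpace Ω] {n k d : ℕ} (P : Measure Ω) (D : ℝ)
    (u : Ω → Vec d) (W : Ω → Fin k → Fin d → ℝ) (V : Ω → Fin n → Fin k → ℝ) : Prop where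
  u_law : HasLaw u (uniformSphere d) P
  W_law : ∀ j l, HasLaw (fun ω => W ω j l) (gaussianReal 0 1) P
  W_indep : iIndepFun (fun (p : Fin k × Fin d) ω => W ω p.1 p.2) P
  W_indep_u : IndepFun W u P
  V_indep : IndepFun V (fun ω => (W ω, u ω)) P
  V_col_indep : iIndepFun (fun (j : Fin k) ω (i : Fin n) => V ω i j) P
  V_col_ident : ∀ j j', IdentDistrib (fun ω (i : Fin n) => V ω i j) (fun ω i => V ω i j') P P
  V_bdd : ∀ᵐ ω ∂P, ∀ i j, |V ω i j| ≤ D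
  V_centered : ∀ i j, ∫ ω, V ω i j ∂P = 0
  V_cov : ∀ j i i', cov[fun ω => V ω i j, fun ω => V ω i' j; P] = if i = i' then 1 else 0

/-- `‖v‖_∞`. -/
def supNorm {a : ℕ} (v : Vec a) : ℝ := ‖v.ofLp‖

/-- `ρ = C ‖A‖ √(n log d) + √m (‖A x‖_∞ + ‖ε‖_∞)`. -/
def initBound {m n : ℕ} (C : ℝ) (d : ℕ) (A : Vec n →L[ℝ] Vec m) (x : Vec n) (ε : Vec m) : ℝ :=
  C * ‖A‖ * √((n : ℝ) * Real.log d) + √(m : ℝ) * (supNorm (A x) + supNorm ε)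

/-- The supremum of `‖∇ℓ(v)‖ / ‖v - y‖` over `v ∈ B(0, ρ)`, `v ≠ y`. -/
def gradRatio {m : ℕ} (ℓ : Vec m → ℝ) (y : Vec m) (ρ : ℝ) : ℝ :=
  sSup ((fun v => ‖gradient ℓ v‖ / ‖v - y‖) '' (closedBall 0 ρ \ {y}))

/-- `(L_{ℓ,0} / 2) ρ²` with `ρ = initBound C d A x ε` and `y = A x + ε`. -/
def initLossBound {m n : ℕ} (C : ℝ) (d : ℕ) (A : Vec n →L[ℝ] Vec m) (x : Vec n) (ε : Vec m)
    (ℓ : Vec m → ℝ) : ℝ :=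
  gradRatio ℓ (A x + ε) (initBound C d A x ε) / 2 * initBound C d A x ε ^ 2

/-- `ν₁ = (1 + γ L) / (1 - γ L / 2)`. -/
def nuOne (γ L : ℝ) : ℝ := (1 + γ * L) / (1 - γ * L / 2)

/-- `R' = 2 ν₁ ψ(ℓ(y₀)) / (σ_A σ_min(J₀))`, where `y₀ = A g(u, θ₀)` and `J₀ = J_g(θ₀)`. -/
def radius' {m n k d : ℕ} (φ ψ : ℝ → ℝ) (ℓ : Vec m → ℝ) (A : Vec n →L[ℝ] Vec m) (u : Vec d)
    (θ₀ : Param n k d) (γ L : ℝ) : ℝ :=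
  2 * nuOne γ L * ψ (ℓ (A (net φ u θ₀))) / (sigmaMin A * sigmaMin (jac φ u θ₀))

/-- The initialization condition `σ_min(J₀) > 0` and `R' < R`, for every `L > 0` and every step
size `γ ∈ (0, 1/L]`. Here `σ_min(J₀) > 0` includes that `J₀` has full row rank `n` (that some
singular value is non-zero would say nothing), and `ψ` is evaluated inside its domain. -/
structure InitCondition {m n k d : ℕ} (φ ψ : ℝ → ℝ) (r₀ : ℝ) (ℓ : Vec m → ℝ)
    (A : Vec n →L[ℝ] Vec m) (u : Vec d) (θ₀ : Param n k d) : Prop where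
  surjective : Function.Surjective (jac φ u θ₀)
  sigmaMin_pos : 0 < sigmaMin (jac φ u θ₀)
  loss_lt : ℓ (A (net φ u θ₀)) < r₀
  radius_lt : ∀ L γ : ℝ, 0 < L → 0 < γ → γ ≤ 1 / L →
    ENNReal.ofReal (radius' φ ψ ℓ A u θ₀ γ L) <
      radius (jac φ u) θ₀ (sigmaMin (jac φ u θ₀))

end DIP

end

/-! Write `c = E φ(N)²` for a standard Gaussian `N`, `s = √(c/2)`, and `q = ψ(a)/σ_A`. Four
estimates at initialization are combined.

Singular value: varying `V` alone gives the map `V ↦ k^{-1/2} V φ(Wu)`, so `σ_min(J) ≥ ‖φ(Wu)‖/√k`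
(`exists_jac_eq`, `le_sigmaMin_of_rightInverse`). For a fixed unit vector `u` the entries of `Wu`
are pairwise independent standard Gaussians, and Chebyshev gives `‖φ(Wu)‖² ≥ kc/2`, hence `σ_min(J)
≥ s`, outside probability `O(1/k)` (`measure_hidden_sq_deviation_le`).

Output: given `(W, u)`, `Vφ(Wu)` is a sum of independent, centered, bounded vectors. A
dimension-free sub-Gaussian tail (`measureReal_norm_sum_ge_le`) gives `‖g(u, θ₀)‖ ≤ C√(n log d)`
outside probability `1/d`. Then `y₀` and `y₀ - y` have norm at most `ρ`, and integrating the
gradient bound from `y` to `y₀` yields `ℓ(y₀) ≤ a` (`IsKL.loss_le`).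

Radius: the Jacobian is Lipschitz on `B(θ₀, r)` with constant at most `B(2 + D√n + r)/√k`
(`lipConst_jac_le`), taking `D ≥ 1` without loss. Since `R' ≤ 8q/s`, it suffices that `r = 8q/s + 1`
is admissible for `R`; this holds once `k` is at least a constant times `n max(1, q)⁴`
(`two_mul_radius_mul_le`).

The maximum with `1`: either `k ≥ C'n` is assumed, or the minimizer is unique. In the latter case
the KL inequality gives the error bound `dist(z, y) ≤ ψ(ℓ(z))` (`IsKL.dist_le_psi`). At a point of
the ball at distance `ρ` from `y` it yields `ψ(a) ≥ ρ ≥ ‖A‖ ≥ σ_A`, so `q ≥ 1`. -/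

namespace DIP

/-! ### Smallest non-zero singular value -/

section SingularValues

variable {E F : Type*} [NormedAddCommGroup E] [InnerProductSpace ℝ E] [FiniteDimensional ℝ E]
  [NormedAddCommGroup F] [InnerProductSpace ℝ F] [FiniteDimensional ℝ F]

theorem finrank_range_pos {F : Type*} [NormedAddCommGroup F] [InnerProductSpace ℝ F]
    {T : E →L[ℝ] F} (hT : T ≠ 0) : 0 < Module.finrank ℝ (LinearMap.range (T : E →ₗ[ℝ] F)) := by
  rw [Nat.pos_iff_ne_zero, Ne, Submodule.finrank_eq_zero, LinearMap.range_eq_bot]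
  intro h
  apply hT
  ext x
  exact congrArg (fun S : E →ₗ[ℝ] F => S x) h

theorem sigmaMin_pos_of_ne_zero {T : E →L[ℝ] F} (hT : T ≠ 0) : 0 < sigmaMin T := by
  have := finrank_range_pos hT
  exact (LinearMap.singularValues_pos_iff_lt_finrank_range _).2 (by omega)

/-- A right singular vector for the smallest non-zero singular value. -/
theorem exists_adjoint_apply_eq_sigmaMin {T : E →L[ℝ] F} (hT : T ≠ 0) :
    ∃ x : E, x ≠ 0 ∧ LinearMap.adjoint (T : E →ₗ[ℝ] F) (T x) = sigmaMin T ^ 2 • x := by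
  have h0 := finrank_range_pos hT
  have h1 : Module.finrank ℝ (LinearMap.range (T : E →ₗ[ℝ] F)) ≤ Module.finrank ℝ E :=
    LinearMap.finrank_range_le _
  obtain ⟨x, hx⟩ := (LinearMap.hasEigenvalue_adjoint_comp_self_sq_singularValues
    (T : E →ₗ[ℝ] F) (n := Module.finrank ℝ (LinearMap.range (T : E →ₗ[ℝ] F)) - 1)
    (by omega)).exists_hasEigenvector
  exact ⟨x, hx.2, hx.apply_eq_smul⟩

theorem norm_apply_sq_of_adjoint_apply_eq {T : E →L[ℝ] F} {x : E} {s : ℝ}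
    (h : LinearMap.adjoint (T : E →ₗ[ℝ] F) (T x) = s ^ 2 • x) : ‖T x‖ ^ 2 = (s * ‖x‖) ^ 2 := by
  have h1 := LinearMap.adjoint_inner_left (T : E →ₗ[ℝ] F) x (T x)
  rw [h, real_inner_smul_left, real_inner_self_eq_norm_sq] at h1
  have h2 : inner ℝ (T x) ((T : E →ₗ[ℝ] F) x) = ‖T x‖ ^ 2 := real_inner_self_eq_norm_sq _
  rw [h2] at h1
  rw [← h1]; ring

theorem sigmaMin_le_norm {T : E →L[ℝ] F} (hT : T ≠ 0) : sigmaMin T ≤ ‖T‖ := by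
  obtain ⟨x, hx0, hx⟩ := exists_adjoint_apply_eq_sigmaMin hT
  have h1 : sigmaMin T * ‖x‖ ≤ ‖T‖ * ‖x‖ := by
    refine le_trans (le_of_eq ?_) (T.le_opNorm x)
    have := norm_apply_sq_of_adjoint_apply_eq hx
    exact ((sq_eq_sq₀ (norm_nonneg _)
      (mul_nonneg (sigmaMin_pos_of_ne_zero hT).le (norm_nonneg _))).1 this).symm
  exact le_of_mul_le_mul_right h1 (norm_pos_iff.2 hx0)

/-- A quantitative right inverse bounds the smallest singular value from below. -/
theorem le_sigmaMin_of_rightInverse [Nontrivial F] {T : E →L[ℝ] F} {s : ℝ}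
    (h : ∀ w, ∃ v, T v = w ∧ s * ‖v‖ ≤ ‖w‖) : s ≤ sigmaMin T := by
  have hT : T ≠ 0 := by
    rintro rfl
    obtain ⟨w, hw⟩ := exists_ne (0 : F)
    obtain ⟨v, hv, -⟩ := h w
    exact hw (by simpa using hv.symm)
  rcases le_or_gt s 0 with hs | hs
  · exact hs.trans (sigmaMin_pos_of_ne_zero hT).le
  have hσ := sigmaMin_pos_of_ne_zero hT
  obtain ⟨x, hx0, hx⟩ := exists_adjoint_apply_eq_sigmaMin hT
  have hn : ‖T x‖ = sigmaMin T * ‖x‖ := (sq_eq_sq₀ (norm_nonneg _)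
      (mul_nonneg hσ.le (norm_nonneg _))).1 (norm_apply_sq_of_adjoint_apply_eq hx)
  obtain ⟨v, hv, hvn⟩ := h (T x)
  -- As `T v = T x`, pairing with `T* T x = σ² x` gives `⟨x, v⟩ = ‖x‖²`: the singular vector `x` is
  -- the shortest preimage of `T x`, so `s‖x‖ ≤ s‖v‖ ≤ ‖T x‖ = σ‖x‖`.
  have h1 := LinearMap.adjoint_inner_left (T : E →ₗ[ℝ] F) v (T x)
  have h2 : inner ℝ (T x) ((T : E →ₗ[ℝ] F) v) = ‖T x‖ ^ 2 := by
    rw [← real_inner_self_eq_norm_sq]; congr 1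
  rw [hx, h2, real_inner_smul_left, hn] at h1
  have h3 : inner ℝ x v ≤ ‖x‖ * ‖v‖ := real_inner_le_norm x v
  have hx' : 0 < ‖x‖ := norm_pos_iff.2 hx0
  have h4 : inner ℝ x v = ‖x‖ ^ 2 := by
    have : sigmaMin T ^ 2 * (inner ℝ x v) = sigmaMin T ^ 2 * ‖x‖ ^ 2 := by rw [h1]; ring
    exact mul_left_cancel₀ (by positivity) this
  have h5 : ‖x‖ ≤ ‖v‖ := by
    rw [h4, sq] at h3
    exact le_of_mul_le_mul_left h3 hx'
  rw [hn] at hvn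
  exact le_of_mul_le_mul_right ((mul_le_mul_of_nonneg_left h5 hs.le).trans hvn) hx'

end SingularValues

/-! ### The network, its Jacobian and the Lipschitz constant of the Jacobian -/

section Network

variable {n k d : ℕ}

/-- The argument of the activation of the `j`-th neuron. -/
noncomputable def preact (u : Vec d) (θ : Param n k d) (j : Fin k) : ℝ :=
  ∑ l, θ (Sum.inr (j, l)) * u l

theorem net_apply (φ : ℝ → ℝ) (u : Vec d) (θ : Param n k d) (i : Fin n) :
    net φ u θ i = 1 / √(k : ℝ) * ∑ j, θ (Sum.inl (i, j)) * φ (preact u θ j) := by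
  simp [net, outerWeights, innerWeights, Matrix.mulVec, dotProduct, preact]

theorem preact_sub (u : Vec d) (θ θ' : Param n k d) (j : Fin k) :
    preact u (θ - θ') j = preact u θ j - preact u θ' j := by
  simp [preact, sub_mul, Finset.sum_sub_distrib]

/-- Each preactivation is affine along the line `θ + t h`, so the product and chain rules in one
variable give each coordinate. -/
theorem jac_apply {φ : ℝ → ℝ} (hφ : Differentiable ℝ φ) (u : Vec d) (θ h : Param n k d)
    (i : Fin n) :
    jac φ u θ h i = 1 / √(k : ℝ) * ∑ j, (h (Sum.inl (i, j)) * φ (preact u θ j) +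
      θ (Sum.inl (i, j)) * (deriv φ (preact u θ j) * preact u h j)) := by
  have hd : DifferentiableAt ℝ (net φ u) θ := by
    rw [differentiableAt_euclidean]
    intro i
    simp only [net_apply, preact]
    fun_prop
  have hcurve : HasDerivAt (fun t : ℝ => θ + t • h) h 0 := by
    simpa using ((hasDerivAt_id (0 : ℝ)).smul_const h).const_add θ
  have h1 : HasDerivAt (fun t : ℝ => net φ u (θ + t • h)) (jac φ u θ h) 0 := by
    have : HasFDerivAt (net φ u) (jac φ u θ) (θ + (0 : ℝ) • h) := by
      simpa [jac] using hd.hasFDerivAt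
    exact this.comp_hasDerivAt 0 hcurve
  have h2 := (hasDerivAt_pi.1 ((PiLp.continuousLinearEquiv 2 ℝ
    (fun _ : Fin n => ℝ)).toContinuousLinearMap.hasFDerivAt.comp_hasDerivAt 0 h1)) i
  have hz : ∀ j, HasDerivAt (fun t : ℝ => preact u (θ + t • h) j) (preact u h j) 0 := by
    intro j
    have : (fun t : ℝ => preact u (θ + t • h) j) = fun t => preact u θ j + t * preact u h j := by
      ext t
      simp [preact, add_mul, Finset.sum_add_distrib, Finset.mul_sum, mul_assoc]
    rw [this]
    simpa using ((hasDerivAt_id (0 : ℝ)).mul_const (preact u h j)).const_add (preact u θ j)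
  have h3 : HasDerivAt (fun t : ℝ => net φ u (θ + t • h) i)
      (1 / √(k : ℝ) * ∑ j, (h (Sum.inl (i, j)) * φ (preact u θ j) +
      θ (Sum.inl (i, j)) * (deriv φ (preact u θ j) * preact u h j))) 0 := by
    simp only [net_apply]
    refine HasDerivAt.const_mul _ (HasDerivAt.fun_sum fun j _ => ?_)
    have hφj : HasDerivAt φ (deriv φ (preact u θ j)) (preact u (θ + (0 : ℝ) • h) j) := by
      simpa using (hφ (preact u θ j)).hasDerivAt
    have hv : HasDerivAt (fun t : ℝ => (θ + t • h) (Sum.inl (i, j))) (h (Sum.inl (i, j))) 0 := by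
      simpa using ((hasDerivAt_id (0 : ℝ)).mul_const (h (Sum.inl (i, j)))).const_add
        (θ (Sum.inl (i, j)))
    have := hv.fun_mul (hφj.comp 0 (hz j))
    simpa [Function.comp_def] using this
  exact h2.unique h3

theorem norm_sq_param (θ : Param n k d) :
    ‖θ‖ ^ 2 = (∑ i, ∑ j, θ (Sum.inl (i, j)) ^ 2) + ∑ j, ∑ l, θ (Sum.inr (j, l)) ^ 2 := by
  rw [EuclideanSpace.norm_sq_eq, Fintype.sum_sum_type, Fintype.sum_prod_type,
    Fintype.sum_prod_type]
  simp

theorem sum_outer_sq_le (θ : Param n k d) : ∑ i, ∑ j, θ (Sum.inl (i, j)) ^ 2 ≤ ‖θ‖ ^ 2 := by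
  rw [norm_sq_param]
  have : 0 ≤ ∑ j, ∑ l, θ (Sum.inr (j, l)) ^ 2 := by positivity
  linarith

/-- Cauchy–Schwarz in each row of `W`: a unit input makes `θ ↦ W u` a contraction. -/
theorem sum_preact_sq_le {u : Vec d} (hu : ‖u‖ = 1) (θ : Param n k d) :
    ∑ j, preact u θ j ^ 2 ≤ ‖θ‖ ^ 2 := by
  have hu' : ∑ l, u l ^ 2 = 1 := by
    have := EuclideanSpace.norm_sq_eq u
    rw [hu] at this
    simpa using this.symm
  have h1 : ∑ j, preact u θ j ^ 2 ≤ ∑ j, ∑ l, θ (Sum.inr (j, l)) ^ 2 := by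
    refine Finset.sum_le_sum fun j _ => ?_
    have := Finset.sum_mul_sq_le_sq_mul_sq Finset.univ (fun l => θ (Sum.inr (j, l))) (fun l => u l)
    rw [hu', mul_one] at this
    exact this
  rw [norm_sq_param]
  have : 0 ≤ ∑ i, ∑ j, θ (Sum.inl (i, j)) ^ 2 := by positivity
  linarith

/-- The matrix-vector product is bounded by the Frobenius norm of the matrix. -/
theorem norm_mulVec_le (M : Fin n → Fin k → ℝ) (x : Fin k → ℝ) {a b : ℝ} (ha : 0 ≤ a) (hb : 0 ≤ b)
    (hM : ∑ i, ∑ j, M i j ^ 2 ≤ a ^ 2) (hx : ∑ j, x j ^ 2 ≤ b ^ 2) :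
    ‖(WithLp.toLp 2 (fun i => ∑ j, M i j * x j) : Vec n)‖ ≤ a * b := by
  refine le_of_sq_le_sq ?_ (by positivity)
  rw [EuclideanSpace.norm_sq_eq]
  calc ∑ i, ‖∑ j, M i j * x j‖ ^ 2 ≤ ∑ i, (∑ j, M i j ^ 2) * ∑ j, x j ^ 2 := by
        refine Finset.sum_le_sum fun i _ => ?_
        rw [Real.norm_eq_abs, sq_abs]
        exact Finset.sum_mul_sq_le_sq_mul_sq _ _ _
    _ = (∑ i, ∑ j, M i j ^ 2) * ∑ j, x j ^ 2 := by rw [Finset.sum_mul]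
    _ ≤ a ^ 2 * b ^ 2 := by gcongr
    _ = (a * b) ^ 2 := by ring

/-- The norm of the `j`-th column of the outer weights. -/
noncomputable def colNorm (θ : Param n k d) (j : Fin k) : ℝ :=
  ‖(WithLp.toLp 2 (fun i => θ (Sum.inl (i, j))) : Vec n)‖

theorem colNorm_le_norm (θ : Param n k d) (j : Fin k) : colNorm θ j ≤ ‖θ‖ := by
  refine le_of_sq_le_sq ?_ (norm_nonneg _)
  refine le_trans ?_ (sum_outer_sq_le θ)
  rw [colNorm, EuclideanSpace.norm_sq_eq]
  refine Finset.sum_le_sum fun i _ => ?_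
  rw [Real.norm_eq_abs, sq_abs]
  exact Finset.single_le_sum (f := fun j => θ (Sum.inl (i, j)) ^ 2) (fun j _ => sq_nonneg _)
    (Finset.mem_univ j)

theorem colNorm_le_add (θ θ' : Param n k d) (j : Fin k) :
    colNorm θ j ≤ colNorm θ' j + colNorm (θ - θ') j := by
  unfold colNorm
  refine le_trans (le_of_eq ?_) (norm_add_le _ _)
  congr 1
  ext i
  simp

/-- A linear combination of the columns, with a bound on the columns. -/
theorem norm_colCombination_le (θ : Param n k d) (x y : Fin k → ℝ) {K a b : ℝ}
    (hK : ∀ j, colNorm θ j ≤ K) (hK0 : 0 ≤ K) (ha : 0 ≤ a) (hb : 0 ≤ b)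
    (hx : ∑ j, x j ^ 2 ≤ a ^ 2) (hy : ∑ j, y j ^ 2 ≤ b ^ 2) :
    ‖(WithLp.toLp 2 (fun i => ∑ j, θ (Sum.inl (i, j)) * (x j * y j)) : Vec n)‖ ≤ K * (a * b) := by
  have h1 : (WithLp.toLp 2 (fun i => ∑ j, θ (Sum.inl (i, j)) * (x j * y j)) : Vec n) =
      ∑ j, (x j * y j) • (WithLp.toLp 2 (fun i => θ (Sum.inl (i, j))) : Vec n) := by
    ext i
    simp [mul_comm]
  rw [h1]
  calc _ ≤ ∑ j, ‖(x j * y j) • (WithLp.toLp 2 (fun i => θ (Sum.inl (i, j))) : Vec n)‖ :=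
        norm_sum_le _ _
    _ ≤ ∑ j, (|x j| * |y j|) * K := by
        refine Finset.sum_le_sum fun j _ => ?_
        rw [norm_smul, Real.norm_eq_abs, abs_mul]
        gcongr
        exact hK j
    _ = K * ∑ j, |x j| * |y j| := by rw [← Finset.sum_mul, mul_comm]
    _ ≤ K * (a * b) := by
        gcongr
        refine le_of_sq_le_sq ?_ (by positivity)
        refine (Finset.sum_mul_sq_le_sq_mul_sq _ _ _).trans ?_
        simp only [sq_abs]
        rw [mul_pow]
        gcongr

/-- The difference splits into the changes of `φ`, of `V` and of `φ'`. Only the last depends on the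
size of `θ'`, and only through its column norms. These are of order `√n` at initialization, whereas
the Frobenius norm of `V` would bring in a further `√k` and cancel the factor `1/√k`. -/
theorem norm_jac_sub_le {φ : ℝ → ℝ} {B : ℝ≥0} (hφ : Differentiable ℝ φ)
    (hB : ∀ x, |deriv φ x| ≤ B) (hL : LipschitzWith B (deriv φ)) {u : Vec d} (hu : ‖u‖ = 1)
    {θ θ' : Param n k d} {K : ℝ} (hK0 : 0 ≤ K) (hK : ∀ j, colNorm θ' j ≤ K) :
    ‖jac φ u θ - jac φ u θ'‖ ≤ B / √(k : ℝ) * (2 + K) * ‖θ - θ'‖ := by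
  refine ContinuousLinearMap.opNorm_le_bound _ (by positivity) fun h => ?_
  have hLφ : LipschitzWith B φ :=
    lipschitzWith_of_nnnorm_deriv_le hφ fun x => by
      rw [← NNReal.coe_le_coe, coe_nnnorm]; exact hB x
  have e : (jac φ u θ - jac φ u θ') h = (1 / √(k : ℝ)) •
      ((WithLp.toLp 2 (fun i => ∑ j, h (Sum.inl (i, j)) * (φ (preact u θ j) - φ (preact u θ' j))) :
          Vec n) +
        (WithLp.toLp 2 (fun i => ∑ j, (θ - θ') (Sum.inl (i, j)) *
          (deriv φ (preact u θ j) * preact u h j)) : Vec n) +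
        (WithLp.toLp 2 (fun i => ∑ j, θ' (Sum.inl (i, j)) *
          ((deriv φ (preact u θ j) - deriv φ (preact u θ' j)) * preact u h j)) : Vec n)) := by
    ext i
    simp only [sub_apply, PiLp.sub_apply, PiLp.smul_apply, PiLp.add_apply,
      jac_apply hφ, smul_eq_mul]
    rw [← mul_sub, ← Finset.sum_sub_distrib, ← Finset.sum_add_distrib, ← Finset.sum_add_distrib]
    congr 1
    refine Finset.sum_congr rfl fun j _ => ?_
    ring
  have hdiff : ∀ f : ℝ → ℝ, LipschitzWith B f →
      ∑ j, (f (preact u θ j) - f (preact u θ' j)) ^ 2 ≤ (B * ‖θ - θ'‖) ^ 2 := by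
    intro f hf
    calc _ ≤ ∑ j, (B : ℝ) ^ 2 * preact u (θ - θ') j ^ 2 := by
          refine Finset.sum_le_sum fun j _ => ?_
          have := hf.dist_le_mul (preact u θ j) (preact u θ' j)
          rw [Real.dist_eq, Real.dist_eq] at this
          rw [← mul_pow, preact_sub]
          refine sq_le_sq.2 (this.trans (le_of_eq ?_))
          rw [abs_mul, abs_of_nonneg B.coe_nonneg]
      _ = (B : ℝ) ^ 2 * ∑ j, preact u (θ - θ') j ^ 2 := by rw [Finset.mul_sum]
      _ ≤ (B : ℝ) ^ 2 * ‖θ - θ'‖ ^ 2 := by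
          gcongr
          exact sum_preact_sq_le hu _
      _ = _ := by ring
  have hder : ∑ j, (deriv φ (preact u θ j) * preact u h j) ^ 2 ≤ (B * ‖h‖) ^ 2 := by
    calc _ ≤ ∑ j, (B : ℝ) ^ 2 * preact u h j ^ 2 := by
          refine Finset.sum_le_sum fun j _ => ?_
          rw [mul_pow]
          gcongr 1
          exact sq_le_sq.2 ((hB _).trans (le_abs_self _))
      _ = (B : ℝ) ^ 2 * ∑ j, preact u h j ^ 2 := by rw [Finset.mul_sum]
      _ ≤ (B : ℝ) ^ 2 * ‖h‖ ^ 2 := by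
          gcongr
          exact sum_preact_sq_le hu _
      _ = _ := by ring
  rw [e, norm_smul]
  have t1 := norm_mulVec_le (fun i j => h (Sum.inl (i, j)))
    (fun j => φ (preact u θ j) - φ (preact u θ' j)) (norm_nonneg h)
    (by positivity : 0 ≤ B * ‖θ - θ'‖) (sum_outer_sq_le h) (hdiff φ hLφ)
  have t2 := norm_mulVec_le (fun i j => (θ - θ') (Sum.inl (i, j)))
    (fun j => deriv φ (preact u θ j) * preact u h j) (norm_nonneg (θ - θ'))
    (by positivity : 0 ≤ B * ‖h‖) (sum_outer_sq_le (θ - θ')) hder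
  have t3 := norm_colCombination_le θ'
    (fun j => deriv φ (preact u θ j) - deriv φ (preact u θ' j)) (fun j => preact u h j) hK hK0
    (by positivity : 0 ≤ B * ‖θ - θ'‖) (norm_nonneg h) (hdiff _ hL) (sum_preact_sq_le hu h)
  rw [Real.norm_of_nonneg (by positivity)]
  calc _ ≤ 1 / √(k : ℝ) * (‖h‖ * (B * ‖θ - θ'‖) + ‖θ - θ'‖ * (B * ‖h‖) +
        K * (B * ‖θ - θ'‖ * ‖h‖)) := by
        gcongr
        exact (norm_add₃_le).trans (add_le_add (add_le_add t1 t2) t3)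
    _ = _ := by ring

theorem lipConst_jac_le {φ : ℝ → ℝ} {B : ℝ≥0} (hφ : Differentiable ℝ φ)
    (hB : ∀ x, |deriv φ x| ≤ B) (hL : LipschitzWith B (deriv φ)) {u : Vec d} (hu : ‖u‖ = 1)
    {θ₀ : Param n k d} {K : ℝ} (hK0 : 0 ≤ K) (hK : ∀ j, colNorm θ₀ j ≤ K) (r : ℝ≥0) :
    lipConst (jac φ u) (closedBall θ₀ r) ≤ ENNReal.ofReal (B / √(k : ℝ) * (2 + (K + r))) := by
  refine iInf₂_le_of_le (Real.toNNReal (B / √(k : ℝ) * (2 + (K + r)))) ?_ le_rfl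
  refine LipschitzOnWith.of_dist_le_mul fun θ _ θ' hθ' => ?_
  rw [dist_eq_norm, dist_eq_norm, Real.coe_toNNReal _ (by positivity)]
  refine norm_jac_sub_le hφ hB hL hu (by positivity) fun j => ?_
  refine (colNorm_le_add θ' θ₀ j).trans (add_le_add (hK j) ((colNorm_le_norm _ j).trans ?_))
  rw [← dist_eq_norm]
  exact hθ'

/-- `radius` is a supremum of admissible radii, so one admissible `r` bounds it from below and the
equation for `R` need not be solved. -/
theorem le_radius_jac {φ : ℝ → ℝ} {B : ℝ≥0} (hφ : Differentiable ℝ φ)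
    (hB : ∀ x, |deriv φ x| ≤ B) (hL : LipschitzWith B (deriv φ)) {u : Vec d} (hu : ‖u‖ = 1)
    {θ₀ : Param n k d} {K σ : ℝ} (hK0 : 0 ≤ K) (hK : ∀ j, colNorm θ₀ j ≤ K) {r : ℝ} (hr : 0 ≤ r)
    (h : 2 * r * (B / √(k : ℝ) * (2 + (K + r))) ≤ σ) :
    ENNReal.ofReal r ≤ radius (jac φ u) θ₀ σ := by
  lift r to ℝ≥0 using hr
  rw [ENNReal.ofReal_coe_nnreal]
  refine le_iSup₂_of_le r ?_ le_rfl
  refine (mul_le_mul_right (lipConst_jac_le hφ hB hL hu hK0 hK r) _).trans ?_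
  refine le_trans (le_of_eq ?_) (ENNReal.ofReal_le_ofReal h)
  rw [ENNReal.ofReal_mul (p := 2 * (r : ℝ)) (by positivity), ENNReal.ofReal_mul (p := 2)
    (by positivity), ENNReal.ofReal_coe_nnreal, ENNReal.ofReal_ofNat]

/-- A right inverse of the Jacobian, obtained by varying the outer weights alone. -/
theorem exists_jac_eq {φ : ℝ → ℝ} (hφ : Differentiable ℝ φ) (u : Vec d) (θ : Param n k d) {s : ℝ}
    (hs : 0 < s) (h : s ^ 2 * k ≤ ∑ j, φ (preact u θ j) ^ 2) (hk : 0 < k) (w : Vec n) :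
    ∃ v, jac φ u θ v = w ∧ s * ‖v‖ ≤ ‖w‖ := by
  set S := ∑ j, φ (preact u θ j) ^ 2 with hS
  have hk' : (0 : ℝ) < k := by exact_mod_cast hk
  have hS0 : 0 < S := lt_of_lt_of_le (by positivity) h
  -- The least-norm solution of `k^{-1/2} V φ(Wu) = w`, namely the rank-one matrix `(√k / S) w
  -- φ(Wu)ᵀ`.
  refine ⟨WithLp.toLp 2 (Sum.elim (fun p => √(k : ℝ) / S * (w p.1 * φ (preact u θ p.2)))
    (fun _ => 0)), ?_, ?_⟩
  · ext i
    rw [jac_apply hφ]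
    simp only [Sum.elim_inl, preact, Sum.elim_inr, zero_mul, Finset.sum_const_zero, mul_zero,
      add_zero]
    change 1 / √(k : ℝ) * ∑ j, √(k : ℝ) / S * (w i * φ (preact u θ j)) * φ (preact u θ j) = w i
    have : ∀ j, √(k : ℝ) / S * (w i * φ (preact u θ j)) * φ (preact u θ j) =
        (√(k : ℝ) / S * w i) * φ (preact u θ j) ^ 2 := fun j => by ring
    simp only [this, ← Finset.mul_sum, ← hS]
    have : √(k : ℝ) ≠ 0 := by positivity
    field_simp
  · refine le_of_sq_le_sq ?_ (norm_nonneg _)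
    rw [mul_pow, norm_sq_param]
    simp only [Sum.elim_inl, Sum.elim_inr]
    have e : ∀ i j, (√(k : ℝ) / S * (w i * φ (preact u θ j))) ^ 2 =
        k / S ^ 2 * w i ^ 2 * φ (preact u θ j) ^ 2 := fun i j => by
      rw [mul_pow, div_pow, Real.sq_sqrt hk'.le]; ring
    simp only [e, ← Finset.mul_sum, ← hS, ← Finset.sum_mul]
    have e2 : ∑ i, w i ^ 2 = ‖w‖ ^ 2 := by rw [EuclideanSpace.norm_sq_eq]; simp
    rw [e2]
    have : s ^ 2 * (k / S ^ 2 * ‖w‖ ^ 2 * S) = (s ^ 2 * k / S) * ‖w‖ ^ 2 := by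
      field_simp
    simp only [ne_eq, OfNat.ofNat_ne_zero, not_false_eq_true, zero_pow, Finset.sum_const_zero,
      add_zero]
    rw [this]
    exact mul_le_of_le_one_left (by positivity) ((div_le_one hS0).2 h)

end Network

/-! ### Growth of the loss and the error bound from the KL inequality -/

theorem eventually_lt_of_hasDerivAt_neg {f : ℝ → ℝ} {f' a : ℝ} (h : HasDerivAt f f' a)
    (hf' : f' < 0) : ∀ᶠ t in nhdsWithin a (Ioi a), f t < f a := by
  have h1 := (hasDerivAt_iff_tendsto_slope.1 h).eventually_lt_const hf'
  have h2 : ∀ᶠ t in nhdsWithin a (Ioi a), slope f a t < 0 :=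
    nhdsWithin_mono a (fun t (ht : a < t) => ht.ne') h1
  filter_upwards [h2, self_mem_nhdsWithin] with t ht hat
  have hat' : 0 < t - a := sub_pos.2 hat
  rw [slope_def_field, div_lt_iff₀ hat'] at ht
  linarith

section Loss

variable {m : ℕ} {ℓ : Vec m → ℝ}

theorem gradient_eq_zero_of_isMinOn {y : Vec m} (h : ∀ v, ℓ y ≤ ℓ v) : gradient ℓ y = 0 := by
  have : IsLocalMin ℓ y := Filter.Eventually.of_forall h
  rw [gradient, this.fderiv_eq_zero, map_zero]

theorem gradRatio_nonneg (ℓ : Vec m → ℝ) (y : Vec m) (ρ : ℝ) : 0 ≤ gradRatio ℓ y ρ := by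
  refine Real.sSup_nonneg ?_
  rintro _ ⟨v, -, rfl⟩
  positivity

theorem norm_gradient_le {y : Vec m} {ρ : ℝ} {K : ℝ≥0}
    (hK : LipschitzOnWith K (gradient ℓ) (closedBall 0 ρ)) (hy : y ∈ closedBall (0 : Vec m) ρ)
    (h0 : gradient ℓ y = 0) {v : Vec m} (hv : v ∈ closedBall (0 : Vec m) ρ) :
    ‖gradient ℓ v‖ ≤ gradRatio ℓ y ρ * ‖v - y‖ := by
  rcases eq_or_ne v y with rfl | hne
  · simp [h0]
  have hpos : ∀ w : Vec m, w ≠ y → 0 < ‖w - y‖ := fun w hw => norm_pos_iff.2 (sub_ne_zero.2 hw)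
  rw [← div_le_iff₀ (hpos v hne)]
  -- The real `sSup` is informative only for a bounded set; here `∇ℓ(y) = 0` makes the Lipschitz
  -- constant `K` a bound for all quotients.
  refine le_csSup ⟨K, ?_⟩ ⟨v, ⟨hv, hne⟩, rfl⟩
  rintro _ ⟨w, ⟨hw, hwy⟩, rfl⟩
  refine (div_le_iff₀ (hpos w hwy)).2 ?_
  have := hK.dist_le_mul w hw y hy
  rwa [h0, dist_zero_right, dist_eq_norm] at this

/-- The segment from `y` to `v` stays in the ball, and along it the derivative of `ℓ` is at most
`L‖v - y‖² t`. Integration over `[0, 1]` produces the factor `1/2`. -/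
theorem le_gradRatio_mul_sq {y : Vec m} {ρ : ℝ} {K : ℝ≥0} (hℓ : Differentiable ℝ ℓ)
    (hK : LipschitzOnWith K (gradient ℓ) (closedBall 0 ρ)) (hy : y ∈ closedBall (0 : Vec m) ρ)
    (hmin : ∀ v, ℓ y ≤ ℓ v) (hy0 : ℓ y = 0) {v : Vec m} (hv : v ∈ closedBall (0 : Vec m) ρ) :
    ℓ v ≤ gradRatio ℓ y ρ / 2 * ‖v - y‖ ^ 2 := by
  set L := gradRatio ℓ y ρ
  have h0 := gradient_eq_zero_of_isMinOn hmin
  have hcurve : ∀ t : ℝ, HasDerivAt (fun t : ℝ => y + t • (v - y)) (v - y) t := fun t => by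
    simpa using ((hasDerivAt_id t).smul_const (v - y)).const_add y
  have hder : ∀ t : ℝ, HasDerivAt (fun t : ℝ => ℓ (y + t • (v - y)))
      (inner ℝ (gradient ℓ (y + t • (v - y))) (v - y)) t := fun t => by
    have := (hℓ (y + t • (v - y))).hasGradientAt.hasFDerivAt.comp_hasDerivAt t (hcurve t)
    exact this
  have hder2 : ∀ t : ℝ, HasDerivAt (fun t : ℝ => L / 2 * ‖v - y‖ ^ 2 * t ^ 2)
      (L * ‖v - y‖ ^ 2 * t) t := fun t => by
    have := (hasDerivAt_pow 2 t).const_mul (L / 2 * ‖v - y‖ ^ 2)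
    refine this.congr_deriv ?_
    push_cast
    ring
  have key := image_le_of_deriv_right_le_deriv_boundary (a := 0) (b := 1)
    (f := fun t : ℝ => ℓ (y + t • (v - y)))
    (f' := fun t => inner ℝ (gradient ℓ (y + t • (v - y))) (v - y))
    (B := fun t : ℝ => L / 2 * ‖v - y‖ ^ 2 * t ^ 2) (B' := fun t => L * ‖v - y‖ ^ 2 * t)
    (fun t _ => (hder t).continuousAt.continuousWithinAt) (fun t _ => (hder t).hasDerivWithinAt)
    (by simp [hy0]) (fun t _ => (hder2 t).continuousAt.continuousWithinAt)
    (fun t _ => (hder2 t).hasDerivWithinAt) (fun t ht => ?_) (right_mem_Icc.2 zero_le_one)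
  · simpa using key
  · have hmem : y + t • (v - y) ∈ closedBall (0 : Vec m) ρ :=
      (convex_closedBall (0 : Vec m) ρ).add_smul_sub_mem hy hv ⟨ht.1, ht.2.le⟩
    have h1 := norm_gradient_le hK hy h0 hmem
    calc _ ≤ ‖gradient ℓ (y + t • (v - y))‖ * ‖v - y‖ := real_inner_le_norm _ _
      _ ≤ L * ‖y + t • (v - y) - y‖ * ‖v - y‖ := by gcongr
      _ = _ := by
        rw [add_sub_cancel_left, norm_smul, Real.norm_of_nonneg ht.1]; ring

/-- The error bound that follows from the Kurdyka–Łojasiewicz inequality. -/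
theorem IsKL.dist_le_psi {ψ : ℝ → ℝ} {r₀ : ℝ} (h : IsKL ψ r₀ ℓ) {y : Vec m}
    (hy : ∀ v, ℓ v = 0 → v = y) {z : Vec m} (hz : ℓ z < r₀) : dist z y ≤ ψ (ℓ z) := by
  have hnn : ∀ v, 0 ≤ ℓ v := fun v => h.min_eq.2 ⟨v, rfl⟩
  have hdiff : Differentiable ℝ ℓ := h.contDiff.differentiable one_ne_zero
  by_contra! hlt
  have hψnn : ∀ v, ℓ v < r₀ → 0 ≤ ψ (ℓ v) := fun v hv => by
    rw [← h.psi_zero]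
    exact h.psi_strictMonoOn.monotoneOn ⟨le_rfl, h.r₀_pos⟩ ⟨hnn v, hv⟩ (hnn v)
  have hρ : 0 < dist z y := (hψnn z hz).trans_lt hlt
  -- A variational argument with penalty slope `c`: the lower bound on `c` keeps the minimizer `w`
  -- below at distance less than `dist z y` from `z`, hence away from `y`; `c < 1` leaves room in
  -- the KL inequality.
  obtain ⟨c, hc1, hc⟩ : ∃ c, ψ (ℓ z) / dist z y < c ∧ c < 1 :=
    exists_between ((div_lt_one hρ).2 hlt)
  have hc0 : 0 < c := (div_nonneg (hψnn z hz) hρ.le).trans_lt hc1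
  rw [div_lt_iff₀ hρ] at hc1
  -- The ball gives compactness, and the sublevel set keeps `ℓ` in `[0, r₀)`, where `ψ` is
  -- continuous.
  set S : Set (Vec m) := closedBall z (dist z y) ∩ {w | ℓ w ≤ ℓ z} with hS
  have hScomp : IsCompact S := (isCompact_closedBall _ _).inter_right
    (isClosed_le hdiff.continuous continuous_const)
  have hcont : ContinuousOn (fun w => ψ (ℓ w) + c * dist w z) S := by
    refine ContinuousOn.add ?_ (by fun_prop)
    exact h.psi_continuousOn.comp hdiff.continuous.continuousOn
      fun w hw => ⟨hnn w, lt_of_le_of_lt hw.2 hz⟩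
  obtain ⟨w, hwS, hw⟩ := hScomp.exists_isMinOn
    ⟨z, mem_closedBall_self hρ.le, le_refl (ℓ z)⟩ hcont
  have hwz : ψ (ℓ w) + c * dist w z ≤ ψ (ℓ z) := by
    have := hw (⟨mem_closedBall_self hρ.le, le_refl (ℓ z)⟩ : z ∈ S)
    simpa using this
  have hwr : ℓ w < r₀ := lt_of_le_of_lt hwS.2 hz
  have hdist : dist w z < dist z y := by
    have := hψnn w hwr
    exact lt_of_mul_lt_mul_left (by linarith) hc0.le
  have hw0 : 0 < ℓ w := by
    refine lt_of_le_of_ne (hnn w) fun h0 => ?_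
    rw [hy w h0.symm, dist_comm] at hdist
    exact lt_irrefl _ hdist
  have hineq := h.ineq w hw0 hwr
  set g := gradient ℓ w with hg
  have hg0 : g ≠ 0 := by
    intro h0
    rw [h0, norm_zero, mul_zero] at hineq
    linarith
  have hgpos : 0 < ‖g‖ := norm_pos_iff.2 hg0
  have hψder : HasDerivAt ψ (deriv ψ (ℓ w)) (ℓ w) :=
    ((h.psi_contDiffOn.differentiableOn one_ne_zero).differentiableAt
      (Ioo_mem_nhds hw0 hwr)).hasDerivAt
  have hcurve : HasDerivAt (fun t : ℝ => w - t • g) (-g) 0 := by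
    simpa using ((hasDerivAt_id (0 : ℝ)).smul_const g).const_sub w
  have hℓder : HasDerivAt (fun t : ℝ => ℓ (w - t • g)) (-‖g‖ ^ 2) 0 := by
    have h1 : HasFDerivAt ℓ (InnerProductSpace.toDual ℝ (Vec m) g) (w - (0 : ℝ) • g) := by
      rw [zero_smul, sub_zero]
      exact (hdiff w).hasGradientAt.hasFDerivAt
    have := h1.comp_hasDerivAt (0 : ℝ) hcurve
    refine HasDerivAt.congr_deriv this ?_
    simp
  have hfder : HasDerivAt (fun t : ℝ => ψ (ℓ (w - t • g)) + c * (‖g‖ * t))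
      (deriv ψ (ℓ w) * -‖g‖ ^ 2 + c * (‖g‖ * 1)) 0 := by
    have h1 : HasDerivAt ψ (deriv ψ (ℓ w)) (ℓ (w - (0 : ℝ) • g)) := by simpa using hψder
    exact (h1.comp (0 : ℝ) hℓder).add (((hasDerivAt_id (0 : ℝ)).const_mul ‖g‖).const_mul c)
  -- Along `w - t g` the term `ψ ∘ ℓ` falls at rate `ψ'(ℓ(w))‖g‖² ≥ ‖g‖`, while the penalty rises at
  -- rate at most `c‖g‖ < ‖g‖`. A small step thus stays in `S` and contradicts minimality.
  have hneg : deriv ψ (ℓ w) * -‖g‖ ^ 2 + c * (‖g‖ * 1) < 0 := by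
    have : c * ‖g‖ < deriv ψ (ℓ w) * ‖g‖ * ‖g‖ := by
      refine mul_lt_mul_of_pos_right (hc.trans_le hineq) hgpos
    nlinarith
  have e1 : ∀ᶠ t in nhdsWithin (0 : ℝ) (Ioi 0), ℓ (w - t • g) < ℓ w := by
    simpa using eventually_lt_of_hasDerivAt_neg hℓder (by nlinarith)
  have e2 : ∀ᶠ t in nhdsWithin (0 : ℝ) (Ioi 0),
      ψ (ℓ (w - t • g)) + c * (‖g‖ * t) < ψ (ℓ w) := by
    simpa using eventually_lt_of_hasDerivAt_neg hfder hneg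
  have e3 : ∀ᶠ t in nhdsWithin (0 : ℝ) (Ioi 0), w - t • g ∈ closedBall z (dist z y) := by
    have hc' : ContinuousAt (fun t : ℝ => dist (w - t • g) z) 0 := by fun_prop
    have : ∀ᶠ t in nhds (0 : ℝ), dist (w - t • g) z < dist z y :=
      hc'.eventually_lt continuousAt_const (by simpa using hdist)
    filter_upwards [nhdsWithin_le_nhds this] with t ht using ht.le
  obtain ⟨t, h1, h2, h3, h4⟩ := (e1.and (e2.and (e3.and self_mem_nhdsWithin))).exists
  have hmin := hw (⟨h3, h1.le.trans hwS.2⟩ : w - t • g ∈ S)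
  have ht : (0 : ℝ) < t := h4
  have htri : dist (w - t • g) z ≤ ‖g‖ * t + dist w z := by
    refine (dist_triangle _ w _).trans (le_of_eq ?_)
    congr 1
    rw [dist_eq_norm, sub_sub_cancel_left, norm_neg, norm_smul, Real.norm_of_nonneg ht.le, mul_comm]
  have : ψ (ℓ w) + c * dist w z ≤ ψ (ℓ (w - t • g)) + c * dist (w - t • g) z := hmin
  nlinarith [mul_le_mul_of_nonneg_left htri hc0.le]

end Loss

/-! ### A hyperbolic cosine inequality in Hilbert space -/

section Cosh

theorem hasSum_cosh_sqrt {t : ℝ} (ht : 0 ≤ t) :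
    HasSum (fun n : ℕ => t ^ n / ((2 * n).factorial : ℝ)) (Real.cosh √t) := by
  have := Real.hasSum_cosh √t
  simpa only [pow_mul, Real.sq_sqrt ht] using this

/-- The power series of `cosh √t` in `t` has non-negative coefficients. -/
theorem convexOn_cosh_sqrt : ConvexOn ℝ (Ici 0) fun t : ℝ => Real.cosh √t := by
  refine ⟨convex_Ici 0, fun x hx y hy a b ha hb hab => ?_⟩
  have hxy : (0 : ℝ) ≤ a • x + b • y := (convex_Ici 0) hx hy ha hb hab
  refine hasSum_le (fun n => ?_) (hasSum_cosh_sqrt hxy)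
    (((hasSum_cosh_sqrt hx).const_smul a).add ((hasSum_cosh_sqrt hy).const_smul b))
  have := (convexOn_pow (𝕜 := ℝ) n).2 hx hy ha hb hab
  simp only [smul_eq_mul] at this ⊢
  rw [mul_div_assoc', mul_div_assoc', ← add_div]
  gcongr

/-- The bound on `r²` is the convex combination of `(p + b)²` and `(p - b)²` with weights `(1 ±
τ)/2`; apply convexity of `cosh √t`. -/
theorem cosh_le_of_sq_le {r p b τ : ℝ} (hr : 0 ≤ r) (hτ : |τ| ≤ 1)
    (h : r ^ 2 ≤ p ^ 2 + b ^ 2 + 2 * p * b * τ) :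
    Real.cosh r ≤ Real.cosh p * Real.cosh b + τ * (Real.sinh p * Real.sinh b) := by
  obtain ⟨h1, h2⟩ := abs_le.1 hτ
  have hconv := convexOn_cosh_sqrt.2 (sq_nonneg (p + b)) (sq_nonneg (p - b))
    (by linarith : 0 ≤ (1 + τ) / 2) (by linarith : 0 ≤ (1 - τ) / 2) (by ring)
  simp only [smul_eq_mul, Real.sqrt_sq_eq_abs, Real.cosh_abs] at hconv
  calc Real.cosh r ≤ Real.cosh √((1 + τ) / 2 * (p + b) ^ 2 + (1 - τ) / 2 * (p - b) ^ 2) := by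
        rw [Real.cosh_le_cosh, abs_of_nonneg hr, abs_of_nonneg (Real.sqrt_nonneg _)]
        refine Real.le_sqrt_of_sq_le (h.trans (le_of_eq ?_))
        ring
    _ ≤ _ := hconv
    _ = _ := by rw [Real.cosh_add, Real.cosh_sub]; ring

variable {E : Type*} [NormedAddCommGroup E] [InnerProductSpace ℝ E]

/-- The right side is affine in `y`, so its `y`-dependent part averages to zero when `y` is centered
and independent of `x`. -/
theorem cosh_norm_add_le {x y : E} {b : ℝ} (hy : ‖y‖ ≤ b) :
    Real.cosh ‖x + y‖ ≤ Real.cosh ‖x‖ * Real.cosh b +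
      Real.sinh ‖x‖ / ‖x‖ * (Real.sinh b / b) * inner ℝ x y := by
  have hb : 0 ≤ b := (norm_nonneg y).trans hy
  rcases eq_or_ne x 0 with rfl | hx
  · simpa [abs_of_nonneg hb] using hy
  rcases hb.eq_or_lt with rfl | hb'
  · have : y = 0 := norm_le_zero_iff.1 hy
    simp [this]
  have hx' : 0 < ‖x‖ := norm_pos_iff.2 hx
  have key := cosh_le_of_sq_le (r := ‖x + y‖) (p := ‖x‖) (b := b) (τ := inner ℝ x y / (‖x‖ * b))
    (norm_nonneg _) ?_ ?_
  · refine key.trans (le_of_eq ?_)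
    field_simp
  · rw [abs_div, abs_of_pos (by positivity : 0 < ‖x‖ * b), div_le_one (by positivity)]
    refine (abs_real_inner_le_norm x y).trans ?_
    gcongr
  · rw [norm_add_sq_real]
    have : 2 * ‖x‖ * b * (inner ℝ x y / (‖x‖ * b)) = 2 * inner ℝ x y := by field_simp
    rw [this]
    have : ‖y‖ ^ 2 ≤ b ^ 2 := by gcongr
    linarith

end Cosh

/-! ### Dimension-free concentration for sums of bounded vectors -/

section Concentration

variable {Ω ι : Type*} [MeasurableSpace Ω] {P : Measure Ω} [IsProbabilityMeasure P] {n : ℕ}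
  {Y : ι → Ω → Vec n} {b : ι → ℝ}

theorem integrable_cosh_norm_sum (hm : ∀ j, AEMeasurable (Y j) P)
    (hb : ∀ j, ∀ᵐ ω ∂P, ‖Y j ω‖ ≤ b j) (s : Finset ι) :
    Integrable (fun ω => Real.cosh ‖∑ j ∈ s, Y j ω‖) P := by
  have hae : ∀ᵐ ω ∂P, ∀ j ∈ s, ‖Y j ω‖ ≤ b j := (ae_ball_iff s.countable_toSet).2 fun j _ => hb j
  refine Integrable.of_bound (C := Real.cosh (∑ j ∈ s, b j)) ?_ ?_
  · have : AEMeasurable (fun ω => ∑ j ∈ s, Y j ω) P := Finset.aemeasurable_fun_sum s fun j _ => hm j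
    exact (Real.continuous_cosh.measurable.comp_aemeasurable this.norm).aestronglyMeasurable
  · filter_upwards [hae] with ω hω
    rw [Real.norm_of_nonneg (Real.cosh_pos _).le, Real.cosh_le_cosh, abs_of_nonneg (norm_nonneg _)]
    exact (norm_sum_le_of_le s hω).trans (le_abs_self _)

/-- Sums of independent, centered, bounded random vectors are sub-Gaussian in norm. -/
theorem integral_cosh_norm_sum_le (hm : ∀ j, AEMeasurable (Y j) P) (hind : iIndepFun Y P)
    (hb : ∀ j, ∀ᵐ ω ∂P, ‖Y j ω‖ ≤ b j) (h0 : ∀ j i, ∫ ω, Y j ω i ∂P = 0) (s : Finset ι) :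
    ∫ ω, Real.cosh ‖∑ j ∈ s, Y j ω‖ ∂P ≤ Real.exp (∑ j ∈ s, b j ^ 2 / 2) := by
  classical
  induction s using Finset.induction_on with
  | empty => simp
  | insert a s ha ih =>
    set X : Ω → Vec n := ∑ j ∈ s, Y j with hX
    have hXapp : ∀ ω, X ω = ∑ j ∈ s, Y j ω := fun ω => by simp [hX]
    have hXm : AEMeasurable X P := Finset.aemeasurable_sum s fun j _ => hm j
    have hXind : IndepFun X (Y a) P := hind.indepFun_finsetSum_of_notMem₀ hm ha
    have hXi : Integrable (fun ω => Real.cosh ‖X ω‖) P := by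
      simpa only [hXapp] using integrable_cosh_norm_sum hm hb s
    -- The coefficient of `⟨X, Y a⟩` in `cosh_norm_add_le`. Independence and centering remove this
    -- term in expectation, leaving the factor `cosh (b a) ≤ exp (b a ^ 2 / 2)`.
    set κ : Vec n → ℝ := fun x => Real.sinh ‖x‖ / ‖x‖ * (Real.sinh (b a) / b a) with hκ
    have hκm : Measurable κ := by
      have : Measurable fun x : Vec n => Real.sinh ‖x‖ :=
        Real.continuous_sinh.measurable.comp measurable_norm
      exact (this.div measurable_norm).mul_const _
    have hcoord : ∀ i, Measurable fun x : Vec n => x i := fun i => by fun_prop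
    have hf : ∀ i, Integrable (fun ω => κ (X ω) * X ω i) P := fun i => by
      refine (hXi.mul_const |Real.sinh (b a) / b a|).mono'
        ((hκm.mul (hcoord i)).comp_aemeasurable hXm).aestronglyMeasurable ?_
      filter_upwards with ω
      have h1 : |X ω i| ≤ ‖X ω‖ := by simpa using PiLp.norm_apply_le (X ω) i
      have h2 : Real.sinh ‖X ω‖ / ‖X ω‖ * |X ω i| ≤ Real.cosh ‖X ω‖ := by
        have hs : 0 ≤ Real.sinh ‖X ω‖ := Real.sinh_nonneg_iff.2 (norm_nonneg _)
        calc _ ≤ Real.sinh ‖X ω‖ / ‖X ω‖ * ‖X ω‖ := by gcongr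
          _ ≤ Real.sinh ‖X ω‖ := by
              rcases eq_or_ne ‖X ω‖ 0 with h | h
              · simp [h]
              · rw [div_mul_cancel₀ _ h]
          _ ≤ _ := (Real.sinh_lt_cosh _).le
      have hs : 0 ≤ Real.sinh ‖X ω‖ / ‖X ω‖ :=
        div_nonneg (Real.sinh_nonneg_iff.2 (norm_nonneg _)) (norm_nonneg _)
      rw [hκ, Real.norm_eq_abs, abs_mul, abs_mul, abs_of_nonneg hs]
      calc _ = Real.sinh ‖X ω‖ / ‖X ω‖ * |X ω i| * |Real.sinh (b a) / b a| := by ring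
        _ ≤ _ := by gcongr
    have hYi : ∀ i, Integrable (fun ω => Y a ω i) P := fun i => by
      refine Integrable.of_bound (C := b a)
        ((hcoord i).comp_aemeasurable (hm a)).aestronglyMeasurable ?_
      filter_upwards [hb a] with ω hω using (PiLp.norm_apply_le (Y a ω) i).trans hω
    have hfY : ∀ i, IndepFun (fun ω => κ (X ω) * X ω i) (fun ω => Y a ω i) P := fun i =>
      hXind.comp (φ := fun x : Vec n => κ x * x i) (ψ := fun x : Vec n => x i)
        (hκm.mul (hcoord i)) (hcoord i)
    have hprod : ∀ i, Integrable (fun ω => κ (X ω) * X ω i * Y a ω i) P := fun i =>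
      (hfY i).integrable_mul (hf i) (hYi i)
    have hzero : ∀ i, ∫ ω, κ (X ω) * X ω i * Y a ω i ∂P = 0 := fun i => by
      rw [(hfY i).integral_fun_mul_eq_mul_integral (hf i).aestronglyMeasurable
        (hYi i).aestronglyMeasurable, h0, mul_zero]
    have hinner : ∀ ω, κ (X ω) * inner ℝ (X ω) (Y a ω) = ∑ i, κ (X ω) * X ω i * Y a ω i :=
      fun ω => by
        rw [PiLp.inner_apply, Finset.mul_sum]
        refine Finset.sum_congr rfl fun i _ => ?_
        simp
        ring
    have hstep : ∫ ω, Real.cosh ‖∑ j ∈ insert a s, Y j ω‖ ∂P ≤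
        ∫ ω, (Real.cosh ‖X ω‖ * Real.cosh (b a) + ∑ i, κ (X ω) * X ω i * Y a ω i) ∂P := by
      refine integral_mono_ae (integrable_cosh_norm_sum hm hb _)
        ((hXi.mul_const _).add (integrable_finsetSum _ fun i _ => hprod i)) ?_
      filter_upwards [hb a] with ω hω
      simp only [Finset.sum_insert ha]
      rw [add_comm, ← hXapp, ← hinner]
      exact cosh_norm_add_le hω
    refine hstep.trans ?_
    rw [integral_add (hXi.mul_const _) (integrable_finsetSum _ fun i _ => hprod i),
      integral_finsetSum _ fun i _ => hprod i, Finset.sum_eq_zero fun i _ => hzero i, add_zero,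
      integral_mul_const, Finset.sum_insert ha, add_comm, Real.exp_add]
    simp only [hXapp]
    exact mul_le_mul ih (Real.cosh_le_exp_half_sq _) (Real.cosh_pos _).le (Real.exp_pos _).le

theorem measureReal_norm_sum_ge_le [Fintype ι] (hm : ∀ j, AEMeasurable (Y j) P)
    (hind : iIndepFun Y P) (hb : ∀ j, ∀ᵐ ω ∂P, ‖Y j ω‖ ≤ b j)
    (h0 : ∀ j i, ∫ ω, Y j ω i ∂P = 0) {β t : ℝ} (hβ : 0 < β) (hbβ : ∑ j, b j ^ 2 ≤ β)
    (ht : 0 ≤ t) :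
    P.real {ω | t ≤ ‖∑ j, Y j ω‖} ≤ 2 * Real.exp (-(t ^ 2 / (2 * β))) := by
  -- Markov's inequality for `cosh (l ‖·‖)`, with the `l` that minimizes `l² β / 2 - l t`; the
  -- factor `2` comes from `cosh x ≥ exp x / 2`.
  set l : ℝ := t / β with hl
  have hl0 : 0 ≤ l := by positivity
  have hmgf := integral_cosh_norm_sum_le (Y := fun j ω => l • Y j ω) (b := fun j => l * b j)
    (P := P) (fun j => (hm j).const_smul l)
    (hind.comp (fun _ x => l • x) fun _ => measurable_const_smul l)
    (fun j => by
      filter_upwards [hb j] with ω hω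
      rw [norm_smul, Real.norm_of_nonneg hl0]
      gcongr)
    (fun j i => by
      simp only [PiLp.smul_apply, smul_eq_mul]
      rw [integral_const_mul, h0, mul_zero]) Finset.univ
  have hcosh_int := integrable_cosh_norm_sum (Y := fun j ω => l • Y j ω) (b := fun j => l * b j)
    (P := P) (fun j => (hm j).const_smul l)
    (fun j => by
      filter_upwards [hb j] with ω hω
      rw [norm_smul, Real.norm_of_nonneg hl0]
      gcongr) Finset.univ
  have hmk := mul_meas_ge_le_integral_of_nonneg
    (ae_of_all _ fun ω => (Real.cosh_pos _).le) hcosh_int (Real.cosh (l * t))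
  have hsub : P.real {ω | t ≤ ‖∑ j, Y j ω‖} ≤
      P.real {ω | Real.cosh (l * t) ≤ Real.cosh ‖∑ j, l • Y j ω‖} := by
    refine measureReal_mono fun ω (hω : t ≤ _) => ?_
    change Real.cosh (l * t) ≤ Real.cosh ‖∑ j, l • Y j ω‖
    rw [← Finset.smul_sum, norm_smul, Real.norm_of_nonneg hl0, Real.cosh_le_cosh,
      abs_of_nonneg (by positivity), abs_of_nonneg (by positivity)]
    gcongr
  have hexp : ∑ j, (l * b j) ^ 2 / 2 ≤ l ^ 2 * β / 2 := by
    simp only [mul_pow, ← Finset.sum_div, ← Finset.mul_sum]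
    gcongr
  have hcosh : Real.exp (l * t) / 2 ≤ Real.cosh (l * t) := by
    rw [Real.cosh_eq]
    have := Real.exp_pos (-(l * t))
    linarith
  have h1 : Real.exp (l * t) / 2 * P.real {ω | t ≤ ‖∑ j, Y j ω‖} ≤ Real.exp (l ^ 2 * β / 2) :=
    calc _ ≤ Real.cosh (l * t) *
          P.real {ω | Real.cosh (l * t) ≤ Real.cosh ‖∑ j, l • Y j ω‖} := by gcongr
      _ ≤ _ := hmk
      _ ≤ _ := hmgf
      _ ≤ _ := Real.exp_le_exp.2 hexp
  have h2 : Real.exp (l ^ 2 * β / 2) = Real.exp (l * t) * Real.exp (-(t ^ 2 / (2 * β))) := by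
    rw [← Real.exp_add]
    congr 1
    rw [hl]
    field_simp
    ring
  rw [h2] at h1
  have h3 := Real.exp_pos (l * t)
  refine le_of_mul_le_mul_left ?_ h3
  linarith

end Concentration

/-! ### Gaussian preactivations and the norm of the hidden layer -/

section Gaussian

variable {φ : ℝ → ℝ}

theorem abs_le_of_abs_deriv_le {B : ℝ≥0} (hφ : Differentiable ℝ φ) (hB : ∀ x, |deriv φ x| ≤ B)
    (x : ℝ) : |φ x| ≤ |φ 0| + B * |x| := by
  have hLφ : LipschitzWith B φ :=
    lipschitzWith_of_nnnorm_deriv_le hφ fun x => by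
      rw [← NNReal.coe_le_coe, coe_nnnorm]; exact hB x
  have := hLφ.dist_le_mul x 0
  rw [Real.dist_eq, Real.dist_eq, sub_zero] at this
  have h2 := abs_sub_abs_le_abs_sub (φ x) (φ 0)
  linarith

/-- `φ` grows at most linearly, so it has a fourth Gaussian moment. This is the finite variance that
Chebyshev's inequality needs. -/
theorem memLp_sq_gaussianReal {B : ℝ≥0} (hφ : Differentiable ℝ φ) (hB : ∀ x, |deriv φ x| ≤ B) :
    MemLp (fun x => φ x ^ 2) 2 (gaussianReal 0 1) := by
  have h4 : MemLp φ 4 (gaussianReal 0 1) := by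
    have hid : MemLp (fun x : ℝ => x) 4 (gaussianReal 0 1) :=
      memLp_id_gaussianReal' 4 ENNReal.ofNat_ne_top
    have habs : MemLp (fun x : ℝ => (B : ℝ) * |x|) 4 (gaussianReal 0 1) :=
      hid.abs.const_mul (B : ℝ)
    have hconst : MemLp (fun _ : ℝ => |φ 0|) 4 (gaussianReal 0 1) := memLp_const _
    have h1 : MemLp (fun x : ℝ => |φ 0| + B * |x|) 4 (gaussianReal 0 1) := hconst.add habs
    refine h1.mono hφ.continuous.aestronglyMeasurable (ae_of_all _ fun x => ?_)
    rw [Real.norm_eq_abs]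
    exact (abs_le_of_abs_deriv_le hφ hB x).trans (le_abs_self _)
  have : ENNReal.HolderTriple 4 4 2 := ⟨by
    rw [← two_mul, show (4 : ℝ≥0∞) = 2 * 2 by norm_num,
      ENNReal.mul_inv (by simp) (by simp), ← mul_assoc,
      ENNReal.mul_inv_cancel (by simp) (by simp), one_mul]⟩
  refine (h4.mul h4 (r := 2)).ae_eq (ae_of_all _ fun x => ?_)
  simp [sq]

/-- The set `φ ≠ 0` is open and non-empty, so it has positive Lebesgue measure, and Lebesgue measure
is absolutely continuous with respect to the Gaussian. -/
theorem integral_sq_gaussianReal_pos {B : ℝ≥0} (hφ : Differentiable ℝ φ)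
    (hB : ∀ x, |deriv φ x| ≤ B) (h0 : ∃ t, φ t ≠ 0) :
    0 < ∫ x, φ x ^ 2 ∂gaussianReal 0 1 := by
  rw [integral_pos_iff_support_of_nonneg (fun x => sq_nonneg _)
    ((memLp_sq_gaussianReal hφ hB).integrable one_le_two)]
  have hopen : IsOpen (Function.support fun x => φ x ^ 2) :=
    (hφ.continuous.pow 2).isOpen_support
  obtain ⟨t, ht⟩ := h0
  have hvol : (volume : Measure ℝ) (Function.support fun x => φ x ^ 2) ≠ 0 :=
    (hopen.measure_pos volume ⟨t, pow_ne_zero 2 ht⟩).ne'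
  refine pos_iff_ne_zero.2 fun h => hvol ?_
  exact gaussianReal_absolutelyContinuous' 0 one_ne_zero h

variable {Ω : Type*} [MeasurableSpace Ω] {P : Measure Ω} [IsProbabilityMeasure P]

theorem map_sum_mul_gaussianReal {d : ℕ} {X : Fin d → Ω → ℝ}
    (hX : ∀ l, HasLaw (X l) (gaussianReal 0 1) P) (hind : iIndepFun X P) (u : Fin d → ℝ)
    (s : Finset (Fin d)) :
    P.map (∑ l ∈ s, fun ω => X l ω * u l) = gaussianReal 0 (∑ l ∈ s, ‖u l‖₊ ^ 2) := by
  classical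
  induction s using Finset.induction_on with
  | empty =>
    simp only [Finset.sum_empty, gaussianReal_zero_var]
    exact (Measure.map_const P (0 : ℝ)).trans (by simp)
  | insert a s ha ih =>
    have hm : ∀ l, AEMeasurable (fun ω => X l ω * u l) P := fun l => (hX l).aemeasurable.mul_const _
    have hind' : iIndepFun (fun l ω => X l ω * u l) P :=
      hind.comp (fun l x => x * u l) fun l => measurable_id.mul_const _
    have h1 : P.map (fun ω => X a ω * u a) = gaussianReal 0 (‖u a‖₊ ^ 2) := by
      have := (hX a).map_eq
      change P.map ((fun x => x * u a) ∘ X a) = _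
      rw [← AEMeasurable.map_map_of_aemeasurable (by fun_prop) (hX a).aemeasurable, this,
        gaussianReal_map_mul_const]
      congr 1
      · simp
      · ext
        simp
    have := gaussianReal_add_gaussianReal_of_indepFun
      (hind'.indepFun_finsetSum_of_notMem₀ hm ha) ih h1
    rw [Finset.sum_insert ha, Finset.sum_insert ha, add_comm, this, add_zero, add_comm]

variable {k d : ℕ} {W : Ω → Fin k → Fin d → ℝ}

theorem hasLaw_preactivation (hW : ∀ j l, HasLaw (fun ω => W ω j l) (gaussianReal 0 1) P)
    (hind : iIndepFun (fun (p : Fin k × Fin d) ω => W ω p.1 p.2) P) {u : Vec d} (hu : ‖u‖ = 1)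
    (j : Fin k) : HasLaw (fun ω => ∑ l, W ω j l * u l) (gaussianReal 0 1) P where
  aemeasurable := Finset.aemeasurable_fun_sum _ fun l _ => (hW j l).aemeasurable.mul_const _
  map_eq := by
    have h1 : iIndepFun (fun l ω => W ω j l) P :=
      hind.precomp (g := fun l => (j, l)) fun l l' h => (Prod.mk.inj h).2
    have h2 := map_sum_mul_gaussianReal (hW j) h1 u Finset.univ
    have h3 : ∑ l, ‖u l‖₊ ^ 2 = 1 := by
      have := EuclideanSpace.norm_sq_eq u
      rw [hu, one_pow] at this
      ext
      push_cast
      exact this.symm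
    rw [h3] at h2
    rw [← h2]
    congr 1
    ext ω
    simp

theorem indepFun_preactivation {P : Measure Ω} (hW : ∀ j l, AEMeasurable (fun ω => W ω j l) P)
    (hind : iIndepFun (fun (p : Fin k × Fin d) ω => W ω p.1 p.2) P) (u : Vec d)
    {j j' : Fin k} (hj : j ≠ j') :
    IndepFun (fun ω => ∑ l, W ω j l * u l) (fun ω => ∑ l, W ω j' l * u l) P := by
  classical
  have h := hind.indepFun_finset₀ ({j} ×ˢ Finset.univ) ({j'} ×ˢ Finset.univ)
    (by
      rw [Finset.disjoint_left]
      rintro ⟨a, l⟩ h1 h2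
      simp only [Finset.mem_product, Finset.mem_singleton, Finset.mem_univ, and_true] at h1 h2
      exact hj (h1.symm.trans h2)) (fun p => hW p.1 p.2)
  have hm : ∀ a : Fin k, Measurable fun x : (({a} ×ˢ Finset.univ : Finset (Fin k × Fin d)) → ℝ) =>
      ∑ l, x ⟨(a, l), by simp⟩ * u l := fun a => by fun_prop
  exact h.comp (hm j) (hm j')

/-- The Chebyshev inequality for the squared norm of the hidden layer. -/
theorem measure_hidden_sq_deviation_le {B : ℝ≥0} (hφ : Differentiable ℝ φ)
    (hB : ∀ x, |deriv φ x| ≤ B) (h0 : ∃ t, φ t ≠ 0) (hk : 0 < k)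
    (hW : ∀ j l, HasLaw (fun ω => W ω j l) (gaussianReal 0 1) P)
    (hind : iIndepFun (fun (p : Fin k × Fin d) ω => W ω p.1 p.2) P) {u : Vec d} (hu : ‖u‖ = 1)
    {c : ℝ} (hc : c = ∫ x, φ x ^ 2 ∂gaussianReal 0 1) :
    P {ω | k * c / 2 ≤ |∑ j, φ (∑ l, W ω j l * u l) ^ 2 - k * c|} ≤
      ENNReal.ofReal (4 * variance (fun x => φ x ^ 2) (gaussianReal 0 1) / c ^ 2 / k) := by
  have hk' : (0 : ℝ) < k := by exact_mod_cast hk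
  have hc0 : 0 < c := hc ▸ integral_sq_gaussianReal_pos hφ hB h0
  have hmem := memLp_sq_gaussianReal hφ hB
  have hsqm : Measurable fun x => φ x ^ 2 := (hφ.continuous.pow 2).measurable
  set Y : Fin k → Ω → ℝ := fun j ω => φ (∑ l, W ω j l * u l) ^ 2 with hY
  have hlaw := hasLaw_preactivation hW hind hu
  have hYmem : ∀ j, MemLp (Y j) 2 P := fun j => by
    refine MemLp.comp_of_map (g := fun x => φ x ^ 2) (f := fun ω => ∑ l, W ω j l * u l) ?_
      (hlaw j).aemeasurable
    rw [(hlaw j).map_eq]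
    exact hmem
  have hYint : ∀ j, ∫ ω, Y j ω ∂P = c := fun j => by
    rw [hc]
    exact (hlaw j).integral_comp hsqm.aestronglyMeasurable
  have hYvar : ∀ j, variance (Y j) P = variance (fun x => φ x ^ 2) (gaussianReal 0 1) := fun j => by
    rw [← (hlaw j).map_eq, variance_map hsqm.aemeasurable (hlaw j).aemeasurable]
    rfl
  have hsum : variance (∑ j, Y j) P = k * variance (fun x => φ x ^ 2) (gaussianReal 0 1) := by
    rw [IndepFun.variance_sum (fun j _ => hYmem j) fun j _ j' _ hj =>
      (indepFun_preactivation (fun j l => (hW j l).aemeasurable) hind u hj).comp hsqm hsqm]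
    simp [hYvar]
  have hmean : ∫ ω, (∑ j, Y j) ω ∂P = k * c := by
    simp only [Finset.sum_apply]
    rw [integral_finsetSum _ fun j _ => (hYmem j).integrable one_le_two]
    simp [hYint]
  have key := meas_ge_le_variance_div_sq (memLp_finsetSum' Finset.univ fun j _ => hYmem j)
    (by positivity : 0 < k * c / 2)
  rw [hsum, hmean] at key
  simp only [Finset.sum_apply] at key
  refine key.trans (le_of_eq ?_)
  congr 1
  field_simp
  ring

theorem ae_norm_eq_one_uniformSphere (d : ℕ) : ∀ᵐ u ∂uniformSphere d, ‖u‖ = 1 := by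
  rw [uniformSphere, ae_map_iff (by fun_prop) (measurableSet_eq_fun (by fun_prop) (by fun_prop))]
  exact ae_of_all _ fun u => by simp

/-- In dimension `0` the normalized measure vanishes and is no law; this excludes `d = 0`. -/
theorem uniformSphere_zero : uniformSphere 0 = 0 := by
  have : (volume : Measure (Vec 0)).toSphere = 0 := by
    rw [Measure.toSphere_eq_zero_iff]
    infer_instance
  rw [uniformSphere, this]
  simp

end Gaussian

/-! ### Probability of a bad initialization -/

section Initialization

variable {Ω : Type*} [MeasurableSpace Ω] {P : Measure Ω} {n k d : ℕ}
  {D : ℝ} {u : Ω → Vec d} {W : Ω → Fin k → Fin d → ℝ} {V : Ω → Fin n → Fin k → ℝ}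

theorem IsInit.dim_pos [IsProbabilityMeasure P] (h : IsInit P D u W V) : 0 < d := by
  rcases Nat.eq_zero_or_pos d with rfl | hd
  · have h1 := h.u_law.map_eq
    rw [uniformSphere_zero] at h1
    have := Measure.isProbabilityMeasure_map h.u_law.aemeasurable
    rw [h1] at this
    have h2 := this.measure_univ
    rw [Measure.coe_zero, Pi.zero_apply] at h2
    exact absurd h2 zero_ne_one
  · exact hd

theorem IsInit.aemeasurable_inner (h : IsInit P D u W V) : AEMeasurable W P :=
  aemeasurable_pi_lambda _ fun j => aemeasurable_pi_lambda _ fun l => (h.W_law j l).aemeasurable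

theorem IsInit.aemeasurable_column (h : IsInit P D u W V) (j : Fin k) :
    AEMeasurable (fun ω i => V ω i j) P := (h.V_col_ident j j).aemeasurable_fst

theorem IsInit.aemeasurable_outer (h : IsInit P D u W V) : AEMeasurable V P :=
  aemeasurable_pi_lambda _ fun i => aemeasurable_pi_lambda _ fun j =>
    (measurable_pi_apply i).comp_aemeasurable (h.aemeasurable_column j)

theorem IsInit.ae_norm_input (h : IsInit P D u W V) : ∀ᵐ ω ∂P, ‖u ω‖ = 1 := by
  have := ae_norm_eq_one_uniformSphere d
  rw [← h.u_law.map_eq] at this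
  exact ae_of_ae_map h.u_law.aemeasurable this

/-- For fixed coefficients, the combination of the columns of `V` is sub-Gaussian. -/
theorem IsInit.measure_norm_outer_ge_le [IsProbabilityMeasure P] (h : IsInit P D u W V) (a : Fin k → ℝ) {β t : ℝ}
    (hD : 0 ≤ D) (hβ : 0 < β) (ha : D ^ 2 * n * ∑ j, a j ^ 2 ≤ β) (ht : 0 ≤ t) :
    P {ω | t ≤ ‖(WithLp.toLp 2 (fun i => ∑ j, V ω i j * a j) : Vec n)‖} ≤
      ENNReal.ofReal (2 * Real.exp (-(t ^ 2 / (2 * β)))) := by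
  set Y : Fin k → Ω → Vec n := fun j ω => WithLp.toLp 2 fun i => V ω i j * a j with hY
  have hg : ∀ j, Measurable fun x : Fin n → ℝ => (WithLp.toLp 2 fun i => x i * a j : Vec n) :=
    fun j => by fun_prop
  have hm : ∀ j, AEMeasurable (Y j) P := fun j => (hg j).comp_aemeasurable (h.aemeasurable_column j)
  have hind : iIndepFun Y P := h.V_col_indep.comp
    (fun j (x : Fin n → ℝ) => (WithLp.toLp 2 fun i => x i * a j : Vec n)) hg
  have hb : ∀ j, ∀ᵐ ω ∂P, ‖Y j ω‖ ≤ D * √n * |a j| := fun j => by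
    filter_upwards [h.V_bdd] with ω hω
    refine le_of_sq_le_sq ?_ (by positivity)
    rw [EuclideanSpace.norm_sq_eq]
    calc ∑ i, ‖V ω i j * a j‖ ^ 2 ≤ ∑ _i : Fin n, D ^ 2 * a j ^ 2 := by
          refine Finset.sum_le_sum fun i _ => ?_
          rw [norm_mul, mul_pow, Real.norm_eq_abs, Real.norm_eq_abs, sq_abs (a j)]
          gcongr
          exact hω i j
      _ = _ := by
          rw [mul_pow, mul_pow, Real.sq_sqrt (by positivity), sq_abs]
          simp
          ring
  have h0 : ∀ j i, ∫ ω, Y j ω i ∂P = 0 := fun j i => by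
    change ∫ ω, V ω i j * a j ∂P = 0
    rw [integral_mul_const, h.V_centered, zero_mul]
  have key := measureReal_norm_sum_ge_le hm hind hb h0 hβ (t := t) (by
    refine le_trans (le_of_eq ?_) ha
    rw [Finset.mul_sum]
    refine Finset.sum_congr rfl fun j _ => ?_
    rw [mul_pow, mul_pow, Real.sq_sqrt (by positivity), sq_abs]) ht
  have e : ∀ ω, (WithLp.toLp 2 (fun i => ∑ j, V ω i j * a j) : Vec n) = ∑ j, Y j ω := fun ω => by
    ext i
    simp [hY]
  simp only [e]
  rw [← ofReal_measureReal]
  exact ENNReal.ofReal_le_ofReal key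

/-- With high probability the hidden layer has norm of order `√k`, and the output is bounded. -/
theorem IsInit.measure_bad_le [IsProbabilityMeasure P] {φ : ℝ → ℝ} {B : ℝ≥0} (hφ : Differentiable ℝ φ)
    (hB : ∀ x, |deriv φ x| ≤ B) (h0 : ∃ t, φ t ≠ 0) {c : ℝ}
    (hc : c = ∫ x, φ x ^ 2 ∂gaussianReal 0 1) (h : IsInit P D u W V) (hk : 0 < k) (hn : 0 < n)
    (hD : 0 < D) {t : ℝ} (ht : 0 ≤ t) :
    P {ω | k * c / 2 ≤ |∑ j, φ (∑ l, W ω j l * u ω l) ^ 2 - k * c| ∨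
        t ≤ ‖(WithLp.toLp 2 (fun i => ∑ j, V ω i j * φ (∑ l, W ω j l * u ω l)) : Vec n)‖} ≤
      ENNReal.ofReal (4 * variance (fun x => φ x ^ 2) (gaussianReal 0 1) / c ^ 2 / k) +
        ENNReal.ofReal (2 * Real.exp (-(t ^ 2 / (3 * D ^ 2 * n * k * c)))) := by
  have hk' : (0 : ℝ) < k := by exact_mod_cast hk
  have hn' : (0 : ℝ) < n := by exact_mod_cast hn
  have hc0 : 0 < c := hc ▸ integral_sq_gaussianReal_pos hφ hB h0
  have hφc := hφ.continuous
  set S₁ : Set ((Fin k → Fin d → ℝ) × Vec d) :=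
    {p | k * c / 2 ≤ |∑ j, φ (∑ l, p.1 j l * p.2 l) ^ 2 - k * c|} with hS₁
  -- A large output counts only when the hidden layer is good. For fixed `(W, u)` the section is
  -- then empty or has `∑ φ² ≤ (3/2) k c`, so that the sub-Gaussian tail applies uniformly after
  -- Fubini.
  set S₂ : Set ((Fin n → Fin k → ℝ) × ((Fin k → Fin d → ℝ) × Vec d)) :=
    {q | q.2 ∉ S₁ ∧ t ≤ ‖(WithLp.toLp 2
      (fun i => ∑ j, q.1 i j * φ (∑ l, q.2.1 j l * q.2.2 l)) : Vec n)‖} with hS₂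
  have hS₁m : MeasurableSet S₁ := by
    rw [hS₁]
    exact measurableSet_le (by fun_prop) (by fun_prop)
  have hS₂m : MeasurableSet S₂ := by
    rw [hS₂]
    have hr : MeasurableSet {q : (Fin n → Fin k → ℝ) × ((Fin k → Fin d → ℝ) × Vec d) |
        t ≤ ‖(WithLp.toLp 2 (fun i => ∑ j, q.1 i j * φ (∑ l, q.2.1 j l * q.2.2 l)) : Vec n)‖} :=
      measurableSet_le (by fun_prop) (by fun_prop)
    exact (measurable_snd hS₁m.compl).inter hr
  have hWu : AEMeasurable (fun ω => (W ω, u ω)) P := h.aemeasurable_inner.prodMk h.u_law.aemeasurable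
  have hVWu : AEMeasurable (fun ω => (V ω, (W ω, u ω))) P := h.aemeasurable_outer.prodMk hWu
  have hb₁ : P {ω | (W ω, u ω) ∈ S₁} ≤
      ENNReal.ofReal (4 * variance (fun x => φ x ^ 2) (gaussianReal 0 1) / c ^ 2 / k) := by
    have := Measure.isProbabilityMeasure_map h.u_law.aemeasurable
    have := Measure.isProbabilityMeasure_map h.aemeasurable_inner
    change P ((fun ω => (W ω, u ω)) ⁻¹' S₁) ≤ _
    rw [← Measure.map_apply_of_aemeasurable hWu hS₁m,
      (indepFun_iff_map_prod_eq_prod_map_map h.aemeasurable_inner h.u_law.aemeasurable).1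
        h.W_indep_u, Measure.prod_apply_symm hS₁m]
    refine (lintegral_mono_ae (g := fun _ => ENNReal.ofReal
      (4 * variance (fun x => φ x ^ 2) (gaussianReal 0 1) / c ^ 2 / k)) ?_).trans (by simp)
    have hae := ae_norm_eq_one_uniformSphere d
    rw [← h.u_law.map_eq] at hae
    filter_upwards [hae] with x hx
    rw [Measure.map_apply_of_aemeasurable h.aemeasurable_inner (measurable_prodMk_right hS₁m)]
    exact measure_hidden_sq_deviation_le hφ hB h0 hk h.W_law h.W_indep hx hc
  have hb₂ : P {ω | (V ω, (W ω, u ω)) ∈ S₂} ≤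
      ENNReal.ofReal (2 * Real.exp (-(t ^ 2 / (3 * D ^ 2 * n * k * c)))) := by
    have := Measure.isProbabilityMeasure_map h.aemeasurable_outer
    have := Measure.isProbabilityMeasure_map hWu
    change P ((fun ω => (V ω, (W ω, u ω))) ⁻¹' S₂) ≤ _
    rw [← Measure.map_apply_of_aemeasurable hVWu hS₂m,
      (indepFun_iff_map_prod_eq_prod_map_map h.aemeasurable_outer hWu).1
        h.V_indep, Measure.prod_apply_symm hS₂m]
    refine (lintegral_mono (g := fun _ => ENNReal.ofReal
      (2 * Real.exp (-(t ^ 2 / (3 * D ^ 2 * n * k * c))))) fun p => ?_).trans (by simp)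
    rw [Measure.map_apply_of_aemeasurable h.aemeasurable_outer (measurable_prodMk_right hS₂m)]
    by_cases hp : p ∈ S₁
    · have : (fun x => (x, p)) ⁻¹' S₂ = ∅ := by
        ext x
        simp [hS₂, hp]
      simp [this]
    · have hlt : |∑ j, φ (∑ l, p.1 j l * p.2 l) ^ 2 - k * c| < k * c / 2 := not_le.1 hp
      have hsum := (abs_lt.1 hlt).2
      have := h.measure_norm_outer_ge_le (fun j => φ (∑ l, p.1 j l * p.2 l))
        (β := 3 / 2 * (D ^ 2 * n * k * c)) hD.le (by positivity)
        (by
          have : ∑ j, φ (∑ l, p.1 j l * p.2 l) ^ 2 ≤ 3 / 2 * (k * c) := by linarith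
          calc _ ≤ D ^ 2 * n * (3 / 2 * (k * c)) := by gcongr
            _ = _ := by ring) ht
      refine (measure_mono fun ω hω => ?_).trans (this.trans (le_of_eq ?_))
      · exact hω.2
      · congr 5
        ring
  refine (measure_mono ?_).trans ((measure_union_le _ _).trans (add_le_add hb₁ hb₂))
  intro ω hω
  by_cases h1 : (W ω, u ω) ∈ S₁
  · exact Or.inl h1
  · exact Or.inr ⟨h1, hω.resolve_left h1⟩

end Initialization

/-! ### Loss bound, lower bound on `ψ`, and the choice of radius -/

section Estimates

theorem nuOne_le {γ L : ℝ} (hL : 0 < L) (h : γ ≤ 1 / L) : nuOne γ L ≤ 4 := by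
  have h1 : γ * L ≤ 1 := (le_div_iff₀ hL).1 h
  rw [nuOne, div_le_iff₀ (by linarith)]
  linarith

theorem nuOne_nonneg {γ L : ℝ} (hL : 0 < L) (hγ : 0 < γ) (h : γ ≤ 1 / L) : 0 ≤ nuOne γ L := by
  have h1 : γ * L ≤ 1 := (le_div_iff₀ hL).1 h
  have h2 : 0 < γ * L := mul_pos hγ hL
  exact div_nonneg (by linarith) (by linarith)

theorem norm_le_sqrt_mul_supNorm {m : ℕ} (v : Vec m) : ‖v‖ ≤ √(m : ℝ) * supNorm v := by
  have h0 : 0 ≤ supNorm v := norm_nonneg _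
  refine le_of_sq_le_sq ?_ (by positivity)
  rw [EuclideanSpace.norm_sq_eq, mul_pow, Real.sq_sqrt (by positivity)]
  calc ∑ i, ‖v i‖ ^ 2 ≤ ∑ _i : Fin m, supNorm v ^ 2 := by
        refine Finset.sum_le_sum fun i _ => ?_
        gcongr
        exact norm_le_pi_norm v.ofLp i
    _ = _ := by simp

/-- The form of `ρ` is dictated by this: it dominates `‖y‖`, `‖y₀‖` and `‖y₀ - y‖` at once when
`‖y₀‖ ≤ C‖A‖√(n log d)`. -/
theorem norm_target_add_le_initBound {m n : ℕ} (C : ℝ) (d : ℕ) (A : Vec n →L[ℝ] Vec m) (x : Vec n)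
    (ε : Vec m) : C * ‖A‖ * √((n : ℝ) * Real.log d) + ‖A x + ε‖ ≤ initBound C d A x ε := by
  rw [initBound, mul_add]
  have := norm_add_le (A x) ε
  have h1 := norm_le_sqrt_mul_supNorm (A x)
  have h2 := norm_le_sqrt_mul_supNorm ε
  linarith

variable {m n : ℕ} {ℓ : Vec m → ℝ} {ψ : ℝ → ℝ} {r₀ : ℝ}

theorem IsKL.psi_mono (h : IsKL ψ r₀ ℓ) {v : Vec m} {a : ℝ} (hv : ℓ v ≤ a) (ha : a < r₀) :
    ψ (ℓ v) ≤ ψ a := by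
  have hnn : 0 ≤ ℓ v := h.min_eq.2 ⟨v, rfl⟩
  exact h.psi_strictMonoOn.monotoneOn ⟨hnn, hv.trans_lt ha⟩ ⟨hnn.trans hv, ha⟩ hv

theorem IsKL.psi_nonneg (h : IsKL ψ r₀ ℓ) {a : ℝ} (ha0 : 0 ≤ a) (ha : a < r₀) : 0 ≤ ψ a := by
  rw [← h.psi_zero]
  exact h.psi_strictMonoOn.monotoneOn ⟨le_rfl, h.r₀_pos⟩ ⟨ha0, ha⟩ ha0

/-- The loss at distance at most `ρ` from the target, inside the ball of radius `ρ`. -/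
theorem IsKL.loss_le {y v : Vec m} {ρ : ℝ} (h : IsKL ψ r₀ ℓ)
    (hlip : ∀ S : Set (Vec m), Bornology.IsBounded S →
      ∃ K : ℝ≥0, LipschitzOnWith K (gradient ℓ) S)
    (hy0 : ℓ y = 0) (hy : ‖y‖ ≤ ρ) (hv : ‖v‖ ≤ ρ) (hvy : ‖v - y‖ ≤ ρ) :
    ℓ v ≤ gradRatio ℓ y ρ / 2 * ρ ^ 2 := by
  obtain ⟨K, hK⟩ := hlip (closedBall 0 ρ) isBounded_closedBall
  have h1 := le_gradRatio_mul_sq (h.contDiff.differentiable one_ne_zero) hK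
    (mem_closedBall_zero_iff.2 hy) (fun w => hy0.trans_le (h.min_eq.2 ⟨w, rfl⟩)) hy0
    (mem_closedBall_zero_iff.2 hv)
  refine h1.trans ?_
  have := gradRatio_nonneg ℓ y ρ
  gcongr

/-- Move from `y = ‖y‖ e` by `ρ` through the origin: `z = (‖y‖ - ρ) e`. -/
theorem exists_norm_sub_eq [NeZero m] {y : Vec m} {ρ : ℝ} (hy : ‖y‖ ≤ ρ) :
    ∃ z : Vec m, ‖z‖ ≤ ρ ∧ ‖z - y‖ = ρ := by
  have hρ : 0 ≤ ρ := (norm_nonneg y).trans hy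
  obtain ⟨e, he, hye⟩ : ∃ e : Vec m, ‖e‖ = 1 ∧ y = ‖y‖ • e := by
    rcases eq_or_ne y 0 with rfl | hy0
    · obtain ⟨e, he⟩ := exists_norm_eq (Vec m) zero_le_one
      exact ⟨e, he, by simp⟩
    · have : ‖y‖ ≠ 0 := norm_ne_zero_iff.2 hy0
      exact ⟨‖y‖⁻¹ • y, by rw [norm_smul, norm_inv, norm_norm, inv_mul_cancel₀ this],
        by rw [smul_smul, mul_inv_cancel₀ this, one_smul]⟩
  refine ⟨y - ρ • e, ?_, ?_⟩
  · conv_lhs => rw [hye, ← sub_smul, norm_smul, he, mul_one, Real.norm_eq_abs]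
    rw [abs_le]
    constructor <;> linarith [norm_nonneg y]
  · rw [sub_sub_cancel_left, norm_neg, norm_smul, he, mul_one, Real.norm_of_nonneg hρ]

/-- If the minimizer of the loss is unique, then `ψ` dominates the radius of the ball. -/
theorem IsKL.le_psi_of_unique [NeZero m] {y : Vec m} {ρ : ℝ} (h : IsKL ψ r₀ ℓ)
    (hlip : ∀ S : Set (Vec m), Bornology.IsBounded S →
      ∃ K : ℝ≥0, LipschitzOnWith K (gradient ℓ) S)
    (hy0 : ℓ y = 0) (hy : ‖y‖ ≤ ρ) (huniq : ∀ v, ℓ v = 0 → v = y)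
    (ha : gradRatio ℓ y ρ / 2 * ρ ^ 2 < r₀) : ρ ≤ ψ (gradRatio ℓ y ρ / 2 * ρ ^ 2) := by
  obtain ⟨z, hz, hzy⟩ := exists_norm_sub_eq hy
  have hℓz := h.loss_le hlip hy0 hy hz hzy.le
  calc ρ = dist z y := by rw [dist_eq_norm, hzy]
    _ ≤ ψ (ℓ z) := h.dist_le_psi huniq (hℓz.trans_lt ha)
    _ ≤ _ := h.psi_mono hℓz ha

/-- The radius `8 q / s + 1` is admissible as soon as `k` is of order `n max(1, q)⁴`. -/
theorem two_mul_radius_mul_le {B D s q : ℝ} {k n : ℕ} (hB : 0 ≤ B) (hD : 0 ≤ D) (hs : 0 < s)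
    (hq : 0 ≤ q) (hn : 0 < n)
    (hk : (2 * B * (8 / s + 1) * (2 + D + (8 / s + 1)) / s) ^ 2 * n ≤ k)
    (hkq : (2 * B * (8 / s + 1) * (2 + D + (8 / s + 1)) / s) ^ 2 * n * q ^ 4 ≤ k) (hk0 : 0 < k) :
    2 * (8 * q / s + 1) * (B / √(k : ℝ) * (2 + (D * √(n : ℝ) + (8 * q / s + 1)))) ≤ s := by
  set α := 8 / s + 1 with hα
  set M := 2 * B * α * (2 + D + α) / s with hM
  have hα0 : 0 < α := by positivity
  have hM0 : 0 ≤ M := by positivity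
  have hk' : (0 : ℝ) < √(k : ℝ) := Real.sqrt_pos.2 (by exact_mod_cast hk0)
  have hn1 : 1 ≤ √(n : ℝ) := by
    rw [Real.one_le_sqrt]
    exact_mod_cast hn
  -- The radius contributes one factor `Q` and the Lipschitz constant at most `√n Q`. Hence `√k ≥ M
  -- √n Q²` is needed, which after squaring gives the fourth power.
  set Q := max 1 q with hQ
  have hQ1 : 1 ≤ Q := le_max_left _ _
  have hqQ : q ≤ Q := le_max_right _ _
  have hkQ : M * √(n : ℝ) * Q ^ 2 ≤ √(k : ℝ) := by
    refine Real.le_sqrt_of_sq_le ?_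
    rw [mul_pow, mul_pow, Real.sq_sqrt (by positivity), ← pow_mul]
    rcases max_choice 1 q with h1 | h1
    · rw [hQ, h1, one_pow, mul_one]
      exact hk
    · rw [hQ, h1]
      exact hkq
  have hr : 8 * q / s + 1 ≤ α * Q := by
    have : 8 * q / s = 8 / s * q := by ring
    rw [this, hα, add_mul, one_mul]
    gcongr
  have hr2 : 2 + (D * √(n : ℝ) + (8 * q / s + 1)) ≤ (2 + D + α) * (√(n : ℝ) * Q) := by
    have e1 : 2 * 1 ≤ 2 * (√(n : ℝ) * Q) := by
      gcongr
      nlinarith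
    have e2 : D * √(n : ℝ) ≤ D * (√(n : ℝ) * Q) := by
      gcongr
      nlinarith
    have e3 : α * Q ≤ α * (√(n : ℝ) * Q) := by
      gcongr
      nlinarith
    nlinarith
  have hq' : 0 ≤ 8 * q / s + 1 := by positivity
  calc _ ≤ 2 * (α * Q) * (B / √(k : ℝ) * ((2 + D + α) * (√(n : ℝ) * Q))) := by gcongr
    _ = s * (M * √(n : ℝ) * Q ^ 2) / √(k : ℝ) := by
        rw [hM]
        field_simp
    _ ≤ s := by
        rw [div_le_iff₀ hk']
        gcongr

end Estimates

/-! ### The initialization condition on the good event -/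

section Deterministic

variable {m n k d : ℕ}

theorem preact_toParam (u : Vec d) (V : Fin n → Fin k → ℝ) (W : Fin k → Fin d → ℝ) (j : Fin k) :
    preact u (toParam V W) j = ∑ l, W j l * u l := rfl

theorem net_toParam (φ : ℝ → ℝ) (u : Vec d) (V : Fin n → Fin k → ℝ) (W : Fin k → Fin d → ℝ) :
    net φ u (toParam V W) = (1 / √(k : ℝ)) •
      (WithLp.toLp 2 (fun i => ∑ j, V i j * φ (∑ l, W j l * u l)) : Vec n) := rfl

theorem colNorm_toParam_le {V : Fin n → Fin k → ℝ} (W : Fin k → Fin d → ℝ) {D : ℝ} (hD : 0 ≤ D)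
    (hV : ∀ i j, |V i j| ≤ D) (j : Fin k) : colNorm (toParam V W) j ≤ D * √(n : ℝ) := by
  rw [mul_comm]
  refine (norm_le_sqrt_mul_supNorm _).trans ?_
  gcongr
  exact (pi_norm_le_iff_of_nonneg hD).2 fun i => hV i j

/-- The initialization condition, from bounds on the hidden layer, the loss and the width. -/
theorem initCondition_of_bounds {φ ψ : ℝ → ℝ} {B : ℝ≥0} {r₀ a s D : ℝ} {ℓ : Vec m → ℝ}
    {A : Vec n →L[ℝ] Vec m} (hφ : Differentiable ℝ φ) (hB : ∀ x, |deriv φ x| ≤ B)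
    (hL : LipschitzWith B (deriv φ)) (hA : A ≠ 0) (hKL : IsKL ψ r₀ ℓ) {u : Vec d} (hu : ‖u‖ = 1)
    {V : Fin n → Fin k → ℝ} {W : Fin k → Fin d → ℝ} (hD : 0 ≤ D) (hV : ∀ i j, |V i j| ≤ D)
    (hs : 0 < s) (hn : 0 < n) (hk : 0 < k)
    (hhidden : s ^ 2 * k ≤ ∑ j, φ (∑ l, W j l * u l) ^ 2)
    (hloss : ℓ (A (net φ u (toParam V W))) ≤ a) (ha : a < r₀)
    (hrad : 2 * (8 * (ψ a / sigmaMin A) / s + 1) *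
      (B / √(k : ℝ) * (2 + (D * √(n : ℝ) + (8 * (ψ a / sigmaMin A) / s + 1)))) ≤ s) :
    InitCondition φ ψ r₀ ℓ A u (toParam V W) := by
  have : NeZero n := ⟨hn.ne'⟩
  set θ := toParam V W
  have hinv := exists_jac_eq hφ u θ hs (by simpa only [θ, preact_toParam] using hhidden) hk
  have hsσ : s ≤ sigmaMin (jac φ u θ) := le_sigmaMin_of_rightInverse hinv
  have hσA := sigmaMin_pos_of_ne_zero hA
  have hσ : 0 < sigmaMin (jac φ u θ) := hs.trans_le hsσ
  have hℓ0 : 0 ≤ ℓ (A (net φ u θ)) := hKL.min_eq.2 ⟨_, rfl⟩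
  have hψ0 := hKL.psi_nonneg hℓ0 (hloss.trans_lt ha)
  have hψa := hKL.psi_mono hloss ha
  refine ⟨fun w => (hinv w).imp fun v hv => hv.1, hσ, hloss.trans_lt ha, fun L γ hL0 hγ hγL => ?_⟩
  have hq : 0 ≤ ψ a / sigmaMin A := div_nonneg (hψ0.trans hψa) hσA.le
  -- `ν₁ ≤ 4` gives `R' ≤ 8 (ψ(a)/σ_A) / s`; the added `1` makes the inequality strict and the
  -- radius positive.
  refine lt_of_lt_of_le ?_ (le_radius_jac hφ hB hL hu (by positivity)
    (colNorm_toParam_le W hD hV) (r := 8 * (ψ a / sigmaMin A) / s + 1) (by positivity)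
    (hrad.trans hsσ))
  rw [ENNReal.ofReal_lt_ofReal_iff (by positivity)]
  refine lt_of_le_of_lt ?_ (lt_add_one _)
  have hν := nuOne_le hL0 hγL
  have hν0 := nuOne_nonneg hL0 hγ hγL
  calc radius' φ ψ ℓ A u θ γ L ≤ 2 * 4 * ψ a / (sigmaMin A * s) := by
        unfold radius'
        gcongr
        linarith
    _ = _ := by
        field_simp
        ring

end Deterministic

/-- Allows `D` to be replaced by `max D 1`, which is positive. -/
theorem IsInit.mono {Ω : Type*} [MeasurableSpace Ω] {n k d : ℕ} {P : Measure Ω} {D D' : ℝ}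
    {u : Ω → Vec d} {W : Ω → Fin k → Fin d → ℝ} {V : Ω → Fin n → Fin k → ℝ}
    (h : IsInit P D u W V) (hD : D ≤ D') : IsInit P D' u W V :=
  { h with V_bdd := by filter_upwards [h.V_bdd] with ω hω i j using (hω i j).trans hD }

theorem two_mul_exp_neg_le_inv {d : ℕ} (hd : 2 ≤ d) {x : ℝ} (hx : 2 * Real.log d ≤ x) :
    2 * Real.exp (-x) ≤ (d : ℝ)⁻¹ := by
  have hd' : (2 : ℝ) ≤ d := by exact_mod_cast hd
  have hd0 : (0 : ℝ) < d := by linarith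
  calc 2 * Real.exp (-x) ≤ 2 * Real.exp (-(2 * Real.log d)) := by gcongr
    _ = 2 * ((d : ℝ) ^ 2)⁻¹ := by
        rw [Real.exp_neg, two_mul (Real.log _), Real.exp_add, Real.exp_log hd0, sq]
    _ ≤ d * ((d : ℝ) ^ 2)⁻¹ := by gcongr
    _ = (d : ℝ)⁻¹ := by field_simp

theorem one_le_mul_log {n d : ℕ} (hn : 2 ≤ n) (hd : 2 ≤ d) : 1 ≤ (n : ℝ) * Real.log d := by
  have hn' : (2 : ℝ) ≤ n := by exact_mod_cast hn
  have hd' : (2 : ℝ) ≤ d := by exact_mod_cast hd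
  have h1 : Real.log 2 ≤ Real.log d := Real.log_le_log (by norm_num) hd'
  have h2 := Real.log_two_gt_d9
  nlinarith

theorem one_sub_le_zero {n d : ℕ} (hn : 0 < n) (hd : 0 < d) (h : n ≤ 2 ∨ d ≤ 1) :
    1 - 2 * (n : ℝ)⁻¹ - (d : ℝ)⁻¹ ≤ 0 := by
  have hn0 : (0 : ℝ) < n := by exact_mod_cast hn
  have hd0 : (0 : ℝ) < d := by exact_mod_cast hd
  have hni : 0 < (n : ℝ)⁻¹ := inv_pos.2 hn0
  have hdi : 0 < (d : ℝ)⁻¹ := inv_pos.2 hd0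
  rcases h with h | h
  · have : (n : ℝ) ≤ 2 := by exact_mod_cast h
    have : (2 : ℝ)⁻¹ ≤ (n : ℝ)⁻¹ := inv_anti₀ hn0 this
    linarith
  · have : (d : ℝ) ≤ 1 := by exact_mod_cast h
    have : (1 : ℝ)⁻¹ ≤ (d : ℝ)⁻¹ := inv_anti₀ hd0 this
    rw [inv_one] at this
    linarith

end DIP

/-! ### Choice of constants and conclusion -/

theorem corollary1 (φ : ℝ → ℝ) (hφ : DIP.IsActivation φ) (hφ0 : ∃ t, φ t ≠ 0) (D : ℝ) :
    ∃ C C' : ℝ, 0 < C ∧ 0 < C' ∧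
      ∀ (m n k d : ℕ) (A : DIP.Vec n →L[ℝ] DIP.Vec m) (x : DIP.Vec n) (ε : DIP.Vec m)
        (ℓ : DIP.Vec m → ℝ) (ψ : ℝ → ℝ) (r₀ : ℝ),
        A ≠ 0 →
        -- assumptions on the loss
        (∀ S : Set (DIP.Vec m), Bornology.IsBounded S →
          ∃ K : ℝ≥0, LipschitzOnWith K (gradient ℓ) S) →
        DIP.IsKL ψ r₀ ℓ →
        ℓ (A x + ε) = 0 →
        -- `ψ` is defined at the point where the bound on `k` evaluates it
        DIP.initLossBound C d A x ε ℓ < r₀ →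
        -- the overparametrization bound
        C' * (DIP.sigmaMin A)⁻¹ ^ 4 * n * ψ (DIP.initLossBound C d A x ε ℓ) ^ 4 ≤ k →
        ((∀ v, ℓ v = 0 → v = A x + ε) ∨ C' * n ≤ k) →
        ∀ {Ω : Type*} [MeasurableSpace Ω] (P : Measure Ω) [IsProbabilityMeasure P]
          (u : Ω → DIP.Vec d) (W : Ω → Fin k → Fin d → ℝ) (V : Ω → Fin n → Fin k → ℝ),
          DIP.IsInit P D u W V →
          ∃ E : Set Ω, MeasurableSet E ∧
            1 - 2 * (n : ℝ)⁻¹ - (d : ℝ)⁻¹ ≤ P.real E ∧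
            ∀ ω ∈ E, DIP.InitCondition φ ψ r₀ ℓ A (u ω) (DIP.toParam (V ω) (W ω)) := by
  obtain ⟨hC1, B, -, hB, hL⟩ := hφ
  have hdiff : Differentiable ℝ φ := hC1.differentiable one_ne_zero
  set c : ℝ := ∫ t, φ t ^ 2 ∂gaussianReal 0 1 with hc
  have hc0 : 0 < c := DIP.integral_sq_gaussianReal_pos hdiff hB hφ0
  set v : ℝ := variance (fun t => φ t ^ 2) (gaussianReal 0 1) with hv
  have hv0 : 0 ≤ v := variance_nonneg _ _
  set D₁ : ℝ := max D 1 with hD₁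
  have hD₁0 : 0 < D₁ := lt_max_of_lt_right one_pos
  set s : ℝ := √(c / 2) with hs
  have hs0 : 0 < s := Real.sqrt_pos.2 (by positivity)
  set M : ℝ := 2 * B * (8 / s + 1) * (2 + D₁ + (8 / s + 1)) / s with hM
  -- `C ≥ 1` gives `ρ ≥ ‖A‖`, and `C² ≥ C ≥ 6 D₁² c` makes the tail exponent at least `2 log d`.
  set C : ℝ := 1 + 6 * D₁ ^ 2 * c with hC
  have hC1 : 1 ≤ C := by
    have : 0 ≤ 6 * D₁ ^ 2 * c := by positivity
    linarith
  -- `4v/c²` brings the Chebyshev bound below `1/n`, `M²` serves the radius inequality, and `1`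
  -- ensures positivity.
  set C' : ℝ := 1 + 4 * v / c ^ 2 + M ^ 2 with hC'
  have hvc : 0 ≤ 4 * v / c ^ 2 := by positivity
  have hC'0 : 0 < C' := by positivity
  refine ⟨C, C', by positivity, hC'0, ?_⟩
  intro m n k d A x ε ℓ ψ r₀ hA hlip hKL hy0 ha hk hor Ω _ P _ u W V hinit
  have hn : 0 < n := by
    rcases Nat.eq_zero_or_pos n with rfl | h
    · exact absurd (Subsingleton.elim A 0) hA
    · exact h
  have hm : NeZero m := ⟨by
    rintro rfl
    exact hA (Subsingleton.elim A 0)⟩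
  have hd := hinit.dim_pos
  by_cases htriv : n ≤ 2 ∨ d ≤ 1
  -- Here the claimed probability is at most `0`, so the empty event suffices.
  · exact ⟨∅, MeasurableSet.empty, by simpa using DIP.one_sub_le_zero hn hd htriv, by simp⟩
  obtain ⟨hn3, hd2⟩ : 3 ≤ n ∧ 2 ≤ d := by omega
  have hn0 : (0 : ℝ) < n := by exact_mod_cast hn
  set y := A x + ε with hy
  set ρ := DIP.initBound C d A x ε with hρ
  set a := DIP.initLossBound C d A x ε ℓ with hadef
  have hρy := DIP.norm_target_add_le_initBound C d A x ε
  rw [← hρ, ← hy] at hρy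
  have hlog := DIP.one_le_mul_log (by omega : 2 ≤ n) hd2
  have hmain : 0 ≤ C * ‖A‖ * √((n : ℝ) * Real.log d) := by positivity
  have hyρ : ‖y‖ ≤ ρ := by linarith
  have hσA := DIP.sigmaMin_pos_of_ne_zero hA
  have ha0 : 0 ≤ a := by
    have := DIP.gradRatio_nonneg ℓ y ρ
    rw [hadef, DIP.initLossBound]
    positivity
  set q := ψ a / DIP.sigmaMin A with hq
  have hq0 : 0 ≤ q := div_nonneg (hKL.psi_nonneg ha0 ha) hσA.le
  have hkq : C' * n * q ^ 4 ≤ k := by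
    refine le_trans (le_of_eq ?_) hk
    rw [hq]
    field_simp
  -- With a unique minimizer, `ψ(a) ≥ ρ ≥ ‖A‖ ≥ σ_A`, so `q ≥ 1` and the main bound on `k` already
  -- contains this one.
  have hkn : C' * n ≤ k := by
    refine hor.elim (fun huniq => ?_) id
    have h1 : ρ ≤ ψ a := hKL.le_psi_of_unique hlip hy0 hyρ huniq ha
    have h2 : DIP.sigmaMin A ≤ ψ a := by
      have h3 : 1 ≤ √((n : ℝ) * Real.log d) := Real.one_le_sqrt.2 hlog
      have h4 : ‖A‖ ≤ C * ‖A‖ * √((n : ℝ) * Real.log d) :=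
        (le_mul_of_one_le_left (norm_nonneg A) hC1).trans
          (le_mul_of_one_le_right (by positivity) h3)
      have := DIP.sigmaMin_le_norm hA
      linarith [norm_nonneg y]
    have h5 : 1 ≤ q ^ 4 := one_le_pow₀ ((one_le_div hσA).2 h2)
    exact (le_mul_of_one_le_right (by positivity) h5).trans hkq
  have hk0 : (0 : ℝ) < k := lt_of_lt_of_le (by positivity) hkn
  have hkpos : 0 < k := by exact_mod_cast hk0
  have hMC : M ^ 2 ≤ C' := by linarith
  have hrad := DIP.two_mul_radius_mul_le (B := B) (D := D₁) (s := s) (q := q) (k := k) (n := n)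
    B.coe_nonneg hD₁0.le hs0 hq0 hn
    (le_trans (by gcongr) hkn) (le_trans (by gcongr) hkq) hkpos
  set τ : ℝ := √(k : ℝ) * (C * √((n : ℝ) * Real.log d)) with hτ
  have hinit' := hinit.mono (le_max_left D 1)
  have hbad := hinit'.measure_bad_le hdiff hB hφ0 hc hkpos hn hD₁0 (t := τ) (by positivity)
  set bad : Set Ω := {ω | k * c / 2 ≤ |∑ j, φ (∑ l, W ω j l * u ω l) ^ 2 - k * c| ∨
    τ ≤ ‖(WithLp.toLp 2 (fun i => ∑ j, V ω i j * φ (∑ l, W ω j l * u ω l)) : DIP.Vec n)‖}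
  set fails : Set Ω := {ω | ¬ DIP.InitCondition φ ψ r₀ ℓ A (u ω) (DIP.toParam (V ω) (W ω))}
  have hsub : fails ≤ᵐ[P] bad := by
    filter_upwards [hinit'.ae_norm_input, hinit'.V_bdd] with ω hu hV hfail
    by_contra hgood
    obtain ⟨hg1, hg2⟩ := not_or.1 hgood
    rw [not_le] at hg1 hg2
    refine hfail (DIP.initCondition_of_bounds hdiff hB hL hA hKL hu hD₁0.le hV hs0 hn hkpos
      ?_ ?_ ha hrad)
    · rw [hs, Real.sq_sqrt (by positivity)]
      linarith [(abs_lt.1 hg1).1]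
    · have hnet : ‖DIP.net φ (u ω) (DIP.toParam (V ω) (W ω))‖ ≤ C * √((n : ℝ) * Real.log d) := by
        rw [DIP.net_toParam, norm_smul, Real.norm_of_nonneg (by positivity), one_div,
          inv_mul_le_iff₀ (Real.sqrt_pos.2 hk0)]
        exact hg2.le
      have hAnet : ‖A (DIP.net φ (u ω) (DIP.toParam (V ω) (W ω)))‖ ≤
          C * ‖A‖ * √((n : ℝ) * Real.log d) := by
        refine (A.le_opNorm _).trans ?_
        calc _ ≤ ‖A‖ * (C * √((n : ℝ) * Real.log d)) := by gcongr
          _ = _ := by ring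
      refine hKL.loss_le hlip hy0 hyρ (by linarith [norm_nonneg y]) ?_
      exact (norm_sub_le _ _).trans (by linarith)
  have hP : P.real fails ≤ (n : ℝ)⁻¹ + (d : ℝ)⁻¹ := by
    have e1 : 4 * v / c ^ 2 / k ≤ (n : ℝ)⁻¹ := by
      rw [div_le_iff₀ hk0, ← div_eq_inv_mul, le_div_iff₀ hn0]
      refine le_trans ?_ hkn
      gcongr
      have := sq_nonneg M
      linarith
    have e2 : 2 * Real.exp (-(τ ^ 2 / (3 * D₁ ^ 2 * n * k * c))) ≤ (d : ℝ)⁻¹ := by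
      refine DIP.two_mul_exp_neg_le_inv hd2 ?_
      have hlogd : 0 ≤ Real.log d := Real.log_natCast_nonneg d
      have : τ ^ 2 / (3 * D₁ ^ 2 * n * k * c) = C ^ 2 / (3 * D₁ ^ 2 * c) * Real.log d := by
        rw [hτ, mul_pow, mul_pow, Real.sq_sqrt hk0.le, Real.sq_sqrt (by positivity)]
        field_simp
      rw [this]
      gcongr
      rw [le_div_iff₀ (by positivity)]
      have h1 : C ≤ C ^ 2 := le_self_pow₀ hC1 two_ne_zero
      linarith
    have e3 : P fails ≤ ENNReal.ofReal ((n : ℝ)⁻¹ + (d : ℝ)⁻¹) := by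
      rw [ENNReal.ofReal_add (by positivity) (by positivity)]
      exact (measure_mono_ae hsub).trans (hbad.trans
        (add_le_add (ENNReal.ofReal_le_ofReal e1) (ENNReal.ofReal_le_ofReal e2)))
    exact ENNReal.toReal_le_of_le_ofReal (by positivity) e3
  -- Measurability of the failure set is not established; its measurable hull has the same measure.
  refine ⟨(toMeasurable P fails)ᶜ, (measurableSet_toMeasurable P fails).compl, ?_, ?_⟩
  · rw [probReal_compl_eq_one_sub (measurableSet_toMeasurable P fails)]
    have : P.real (toMeasurable P fails) = P.real fails := by
      simp [measureReal_def, measure_toMeasurable]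
    have hni : 0 < (n : ℝ)⁻¹ := inv_pos.2 hn0
    linarith
  · intro ω hω
    by_contra hcon
    exact hω (subset_toMeasurable P fails hcon)
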